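/- A graph $G=(G^0,G^1,i,t)$ consists of finite sets $G^0$ of vertices and $G^1$ of directed edges, an edge $e$ going from $i(e)$ to $t(e)$ (loops and multiple edges are allowed); all graphs are assumed to have no sources and no sinks, i.e. every vertex is the terminal vertex of some edge and the initial vertex of some edge. $G$ is irreducible if $G^0\neq\varnothing$ and for all vertices $v,w$ there is a path from $v$ to $w$. $A_G$ is the adjacency matrix, $(A_G)_{vw}=|\{e\in G^1 : i(e)=v,\ t(e)=w\}|$, and $(\Sigma_G,\sigma)$ is the space of bi-infinite paths $\Sigma_G=\{(e^k)_{k\in\mathbb Z} : e^k\in G^1,\ t(e^k)=i(e^{k+1})\}$ with the shift $\sigma(e)^k=e^{k+1}$ and the metric $d(e,f)=\inf\big(\{1\}\cup\{2^{-K-1} : K\ge 0,\ e \text{ and } f \text{ agree at the places } 1-K,\dots,K\}\big)$, where agreement for $K=0$ means $t(e^0)=t(f^0)$. A Smale space $(X,\varphi)$ is a compact metric space $X$ with a homeomorphism $\varphi:X\to X$ for which there are constants $\varepsilon>0$, $0<\lambda<1$ and a continuous map $(x,y)\mapsto[x,y]\in X$, defined for $d(x,y)\le\varepsilon$, such that $[x,x]=x$,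 $[x,[y,z]]=[x,z]$, $[[x,y],z]=[x,z]$ and $\varphi[x,y]=[\varphi(x),\varphi(y)]$ whenever both sides are defined, $d(\varphi(x),\varphi(y))\le\lambda d(x,y)$ whenever $[x,y]=y$, and $d(\varphi^{-1}(x),\varphi^{-1}(y))\le\lambda d(x,y)$ whenever $[x,y]=x$. Put $X^s(x)=\{y : \lim_{n\to+\infty}d(\varphi^n(x),\varphi^n(y))=0\}$ and $X^u(x)=\{y : \lim_{n\to+\infty}d(\varphi^{-n}(x),\varphi^{-n}(y))=0\}$. A factor map $\pi:(Y,\psi)\to(X,\varphi)$ is a continuous surjection $\pi:Y\to X$ with $\pi\circ\psi=\varphi\circ\pi$. It is finite-to-one if every point of $X$ has only finitely many preimages, s-bijective if for every $y\in Y$ it restricts to a bijection $Y^s(y)\to X^s(\pi(y))$, and u-bijective if for every $y\in Y$ it restricts to a bijection $Y^u(y)\to X^u(\pi(y))$. Smale spaces $(X,\varphi)$ and $(Y,\psi)$ are finitely equivalent if there are a Smale space $(M,\mu)$ and finite-to-one factor maps $(M,\mu)\to(X,\varphi)$ and $(M,\mu)\to(Y,\psi)$. A correspondence from $(X,\varphi)$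 to $(Y,\psi)$ consists of a Smale space $(M,\mu)$, a u-bijective factor map $\pi_u:(M,\mu)\to(X,\varphi)$ and an s-bijective factor map $\pi_s:(M,\mu)\to(Y,\psi)$. Theorem. Let $G$ and $H$ be irreducible graphs. Then the following are equivalent: (1) $(\Sigma_G,\sigma)$ and $(\Sigma_H,\sigma)$ are finitely equivalent; (2) $(\Sigma_G,\sigma)$ and $(\Sigma_H,\sigma)$ have equal topological entropy; (3) there exists a matrix $F\neq0$ with nonnegative integer entries, with rows indexed by $H^0$ and columns indexed by $G^0$, such that $FA_G=A_HF$; (4) there is a correspondence from $(\Sigma_G,\sigma)$ to $(\Sigma_H,\sigma)$. -/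

import Mathlib

open Filter Topology

universe u v w u₁ v₁ u₂ v₂

noncomputable section

namespace SmaleCorr

/-! ### Smale spaces -/

section Smale

variable {X : Type u} [MetricSpace X] {Y : Type v} [MetricSpace Y]

/-- `IsSmaleBracket φ ε l br` says that `br`, restricted to the pairs at distance at most `ε`, is a
bracket map for the homeomorphism `φ` with constants `ε` and `l`. Only the values of `br` on pairs
at distance at most `ε` matter: every axiom is required exactly when both of its sides are
defined. -/
structure IsSmaleBracket (φ : X ≃ₜ X) (ε l : ℝ) (br : X → X → X) : Prop where
  continuousOn : ContinuousOn (fun p : X × X => br p.1 p.2) {p | dist p.1 p.2 ≤ ε}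
  b1 : ∀ x, br x x = x
  b2 : ∀ x y z, dist y z ≤ ε → dist x (br y z) ≤ ε → dist x z ≤ ε → br x (br y z) = br x z
  b3 : ∀ x y z, dist x y ≤ ε → dist (br x y) z ≤ ε → dist x z ≤ ε → br (br x y) z = br x z
  b4 : ∀ x y, dist x y ≤ ε → dist (φ x) (φ y) ≤ ε → φ (br x y) = br (φ x) (φ y)
  c1 : ∀ x y, dist x y ≤ ε → br x y = y → dist (φ x) (φ y) ≤ l * dist x y
  c2 : ∀ x y, dist x y ≤ ε → br x y = x → dist (φ.symm x) (φ.symm y) ≤ l * dist x y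

/-- The pair `(X, φ)` is a Smale space: `X` is a compact metric space and `φ` is a homeomorphism of
`X` that admits a bracket map. -/
structure IsSmaleSpace (φ : X ≃ₜ X) : Prop where
  compact : CompactSpace X
  exists_bracket : ∃ (ε l : ℝ) (br : X → X → X), 0 < ε ∧ 0 < l ∧ l < 1 ∧ IsSmaleBracket φ ε l br

/-- The global stable set `X^s(x)`. -/
def stableSet (φ : X ≃ₜ X) (x : X) : Set X :=
  {y | Tendsto (fun n : ℕ => dist (φ^[n] x) (φ^[n] y)) atTop (𝓝 0)}

/-- The global unstable set `X^u(x)`. -/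
def unstableSet (φ : X ≃ₜ X) (x : X) : Set X :=
  {y | Tendsto (fun n : ℕ => dist (φ.symm^[n] x) (φ.symm^[n] y)) atTop (𝓝 0)}

/-- `π : (Y, ψ) → (X, φ)` is a factor map. -/
structure IsFactorMap (ψ : Y ≃ₜ Y) (φ : X ≃ₜ X) (π : Y → X) : Prop where
  continuous : Continuous π
  semiconj : Function.Semiconj π ψ φ
  surjective : Function.Surjective π

/-- Every point has only finitely many preimages. -/
def FiniteToOne {A : Type*} {B : Type*} (π : A → B) : Prop :=
  ∀ b, (π ⁻¹' {b}).Finite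

/-- `π : (Y, ψ) → (X, φ)` is an s-bijective (factor) map: it maps each stable set bijectively onto
the stable set of the image point. -/
structure IsSBijective (ψ : Y ≃ₜ Y) (φ : X ≃ₜ X) (π : Y → X) : Prop extends
    IsFactorMap ψ φ π where
  bijOn : ∀ y, Set.BijOn π (stableSet ψ y) (stableSet φ (π y))

/-- `π : (Y, ψ) → (X, φ)` is a u-bijective (factor) map: it maps each unstable set bijectively onto
the unstable set of the image point. -/
structure IsUBijective (ψ : Y ≃ₜ Y) (φ : X ≃ₜ X) (π : Y → X) : Prop extends
    IsFactorMap ψ φ π where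
  bijOn : ∀ y, Set.BijOn π (unstableSet ψ y) (unstableSet φ (π y))

/-- `(X, φ)` and `(Y, ψ)` are finitely equivalent: they are the images of a common Smale space
`(M, μ)` under finite-to-one factor maps. -/
def FinitelyEquivalent (φ : X ≃ₜ X) (ψ : Y ≃ₜ Y) : Prop :=
  ∃ (M : Type w) (_ : MetricSpace M) (μ : M ≃ₜ M) (πX : M → X) (πY : M → Y),
    IsSmaleSpace μ ∧
    (IsFactorMap μ φ πX ∧ FiniteToOne πX) ∧ (IsFactorMap μ ψ πY ∧ FiniteToOne πY)

/-- There is a correspondence from `(X, φ)` to `(Y, ψ)`: a Smale space `(M, μ)` with a u-bijective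
map to `(X, φ)` and an s-bijective map to `(Y, ψ)`. -/
def ExistsCorrespondence (φ : X ≃ₜ X) (ψ : Y ≃ₜ Y) : Prop :=
  ∃ (M : Type w) (_ : MetricSpace M) (μ : M ≃ₜ M) (πu : M → X) (πs : M → Y),
    IsSmaleSpace μ ∧ IsUBijective μ φ πu ∧ IsSBijective μ ψ πs

/-- The topological entropy of `(X, φ)` (the Bowen-Dinaburg definition). -/
def entropy (φ : X ≃ₜ X) : EReal :=
  Dynamics.coverEntropy φ Set.univ

end Smale

/-! ### Directed graphs and their edge shifts -/

/-- A directed graph with vertex set `V` and edge set `E`, in which the edge `e` goes from `i e` to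
`t e`; loops and multiple edges are allowed. -/
structure Graph (V : Type u) (E : Type v) where
  i : E → V
  t : E → V

namespace Graph

variable {V : Type u} {E : Type v} (G : Graph V E)

/-- Every vertex is the terminal vertex of some edge and the initial vertex of some edge. -/
def NoSourcesOrSinks : Prop :=
  (∀ v, ∃ e, G.t e = v) ∧ (∀ v, ∃ e, G.i e = v)

/-- The graph has a vertex, and there is a path from every vertex to every vertex. -/
def IsIrreducible : Prop :=
  Nonempty V ∧ ∀ v w, Relation.ReflTransGen (fun a b => ∃ e, G.i e = a ∧ G.t e = b) v w

/-- The adjacency matrix: the entry at `(v, w)` is the number of edges from `v` to `w`. -/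
def adj : Matrix V V ℕ :=
  Matrix.of fun v w => Nat.card {e : E // G.i e = v ∧ G.t e = w}

/-- The space `Σ_G` of bi-infinite paths in `G`. -/
@[ext]
structure Shift : Type v where
  edge : ℤ → E
  valid : ∀ k, G.t (edge k) = G.i (edge (k + 1))

variable {G}

/-- The paths `x` and `y` agree at the places `1 - K, …, K`; for `K = 0` this means that they pass
through the same vertex between the places `0` and `1`. -/
def Agree (x y : G.Shift) (K : ℕ) : Prop :=
  G.t (x.edge 0) = G.t (y.edge 0) ∧ ∀ k : ℤ, 1 - (K : ℤ) ≤ k → k ≤ K → x.edge k = y.edge k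

/-- The set over which the infimum is taken in the definition of the distance. -/
def distSet (x y : G.Shift) : Set ℝ :=
  insert 1 {r | ∃ K : ℕ, Agree x y K ∧ r = (1 / 2 : ℝ) ^ (K + 1)}

/-- The distance of `x` and `y` is the infimum of `1` and all `2 ^ (-K - 1)` for which the paths
`x` and `y` agree at the places `1 - K, …, K`. -/
instance : Dist G.Shift where
  dist x y := sInf (distSet x y)

theorem Agree.mono {x y : G.Shift} {K L : ℕ} (h : Agree x y L) (hKL : K ≤ L) : Agree x y K :=
  ⟨h.1, fun k h1 h2 => h.2 k (by omega) (by omega)⟩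

theorem Agree.symm {x y : G.Shift} {K : ℕ} (h : Agree x y K) : Agree y x K :=
  ⟨h.1.symm, fun k h1 h2 => (h.2 k h1 h2).symm⟩

theorem Agree.trans {x y z : G.Shift} {K : ℕ} (h : Agree x y K) (h' : Agree y z K) :
    Agree x z K :=
  ⟨h.1.trans h'.1, fun k h1 h2 => (h.2 k h1 h2).trans (h'.2 k h1 h2)⟩

theorem distSet_pos {x y : G.Shift} {r : ℝ} (hr : r ∈ distSet x y) : 0 < r := by
  rcases hr with rfl | ⟨K, -, rfl⟩ <;> positivity

theorem distSet_bddBelow (x y : G.Shift) : BddBelow (distSet x y) :=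
  ⟨0, fun _ hr => (distSet_pos hr).le⟩

theorem distSet_nonempty (x y : G.Shift) : (distSet x y).Nonempty :=
  ⟨1, Set.mem_insert _ _⟩

theorem dist_le_one' (x y : G.Shift) : dist x y ≤ 1 :=
  csInf_le (distSet_bddBelow x y) (Set.mem_insert _ _)

theorem Agree.dist_le {x y : G.Shift} {K : ℕ} (h : Agree x y K) :
    dist x y ≤ (1 / 2 : ℝ) ^ (K + 1) :=
  csInf_le (distSet_bddBelow x y) (Set.mem_insert_of_mem _ ⟨K, h, rfl⟩)

theorem agree_of_dist_lt {x y : G.Shift} {K : ℕ} (h : dist x y < (1 / 2 : ℝ) ^ K) :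
    Agree x y K := by
  obtain ⟨r, hr, hrK⟩ := exists_lt_of_csInf_lt (distSet_nonempty x y) h
  rcases hr with rfl | ⟨L, hL, rfl⟩
  · exact absurd (pow_le_one₀ (by norm_num) (by norm_num) : (1 / 2 : ℝ) ^ K ≤ 1) (not_le.2 hrK)
  · refine hL.mono ?_
    by_contra hlt
    have : (1 / 2 : ℝ) ^ K ≤ (1 / 2) ^ (L + 1) :=
      pow_le_pow_of_le_one (by norm_num) (by norm_num) (by omega)
    linarith

theorem dist_le_pow_iff {x y : G.Shift} {K : ℕ} :
    dist x y ≤ (1 / 2 : ℝ) ^ (K + 1) ↔ Agree x y K := by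
  refine ⟨fun h => agree_of_dist_lt (h.trans_lt ?_), Agree.dist_le⟩
  exact pow_lt_pow_right_of_lt_one₀ (by norm_num) (by norm_num) (Nat.lt_succ_self K)

instance : MetricSpace G.Shift where
  dist_self x := by
    have h : ∀ K, dist x x ≤ (1 / 2 : ℝ) ^ (K + 1) :=
      fun K => Agree.dist_le ⟨rfl, fun _ _ _ => rfl⟩
    refine le_antisymm ?_ (le_csInf (distSet_nonempty x x) fun _ hr => (distSet_pos hr).le)
    have ht : Tendsto (fun K : ℕ => (1 / 2 : ℝ) ^ (K + 1)) atTop (𝓝 0) :=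
      (tendsto_pow_atTop_nhds_zero_of_lt_one (by norm_num) (by norm_num)).comp
        (tendsto_add_atTop_nat 1)
    exact ge_of_tendsto' ht h
  dist_comm x y := by
    have : distSet x y = distSet y x := by
      ext r
      constructor <;>
      · rintro (rfl | ⟨K, hK, rfl⟩)
        · exact Set.mem_insert _ _
        · exact Set.mem_insert_of_mem _ ⟨K, hK.symm, rfl⟩
    change sInf _ = sInf _
    rw [this]
  dist_triangle x y z := by
    have key : ∀ a ∈ distSet x y, ∀ b ∈ distSet y z, dist x z ≤ a + b := by
      intro a ha b hb
      have ha0 := distSet_pos ha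
      have hb0 := distSet_pos hb
      rcases ha with rfl | ⟨K, hK, rfl⟩
      · linarith [dist_le_one' x z]
      rcases hb with rfl | ⟨L, hL, rfl⟩
      · linarith [dist_le_one' x z]
      rcases le_total K L with h | h
      · linarith [(hK.trans (hL.mono h)).dist_le]
      · linarith [((hK.mono h).trans hL).dist_le]
    have h1 : ∀ a ∈ distSet x y, dist x z - a ≤ dist y z := fun a ha =>
      le_csInf (distSet_nonempty y z) fun b hb => by linarith [key a ha b hb]
    have h2 : dist x z - dist y z ≤ dist x y :=
      le_csInf (distSet_nonempty x y) fun a ha => by linarith [h1 a ha]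
    linarith
  eq_of_dist_eq_zero {x y} h := by
    have hA : ∀ K, Agree x y K := fun K =>
      agree_of_dist_lt (lt_of_eq_of_lt h (by positivity))
    refine Shift.ext (funext fun k => ?_)
    exact (hA (k.natAbs + 1)).2 k (by omega) (by omega)

/-- Distance at most `1 / 2` means passing through the same vertex between the places `0`, `1`. -/
theorem dist_le_half_iff {x y : G.Shift} :
    dist x y ≤ 1 / 2 ↔ G.t (x.edge 0) = G.t (y.edge 0) := by
  have h := dist_le_pow_iff (x := x) (y := y) (K := 0)
  rw [zero_add, pow_one] at h
  rw [h]
  exact ⟨fun h => h.1, fun h => ⟨h, fun k h1 h2 => by push_cast at h1 h2; omega⟩⟩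

theorem continuousOn_of_agree {Z : Type*} [PseudoMetricSpace Z] {s : Set Z} {f : Z → G.Shift}
    (h : ∀ z ∈ s, ∀ K : ℕ, ∃ δ > 0, ∀ z' ∈ s, dist z' z < δ → Agree (f z') (f z) K) :
    ContinuousOn f s := by
  rw [Metric.continuousOn_iff]
  intro z hz ε hε
  obtain ⟨K, hK⟩ := exists_pow_lt_of_lt_one hε (by norm_num : (1 / 2 : ℝ) < 1)
  obtain ⟨δ, hδ, hd⟩ := h z hz K
  refine ⟨δ, hδ, fun z' hz' hzz' => ((hd z' hz' hzz').dist_le.trans ?_).trans_lt hK⟩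
  exact pow_le_pow_of_le_one (by norm_num) (by norm_num) (Nat.le_succ K)

variable (G) in
/-- The shift map `σ(e)^k = e^{k+1}` as a homeomorphism of `Σ_G`. -/
def shift : G.Shift ≃ₜ G.Shift where
  toFun x := ⟨fun k => x.edge (k + 1), fun k => x.valid (k + 1)⟩
  invFun x := ⟨fun k => x.edge (k - 1), fun k => by
    have := x.valid (k - 1)
    rwa [show k - 1 + 1 = k + 1 - 1 by ring] at this⟩
  left_inv x := Shift.ext (funext fun k => congrArg x.edge (by simp))
  right_inv x := Shift.ext (funext fun k => congrArg x.edge (by simp))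
  continuous_toFun := by
    rw [← continuousOn_univ]
    refine continuousOn_of_agree fun z _ K => ⟨(1 / 2) ^ (K + 1), by positivity, fun z' _ h => ?_⟩
    have hA := agree_of_dist_lt h
    refine ⟨congrArg G.t (hA.2 (0 + 1) (by push_cast; omega) (by push_cast; omega)), ?_⟩
    exact fun k h1 h2 => hA.2 (k + 1) (by push_cast; omega) (by push_cast; omega)
  continuous_invFun := by
    rw [← continuousOn_univ]
    refine continuousOn_of_agree fun z _ K => ⟨(1 / 2) ^ (K + 1), by positivity, fun z' _ h => ?_⟩
    have hA := agree_of_dist_lt h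
    refine ⟨?_, fun k h1 h2 => hA.2 (k - 1) (by push_cast; omega) (by push_cast; omega)⟩
    have h0 := hA.2 (0 - 1 + 1) (by push_cast; omega) (by push_cast; omega)
    change G.t (z'.edge (0 - 1)) = G.t (z.edge (0 - 1))
    rw [z'.valid, z.valid, h0]

theorem shift_apply (x : G.Shift) (k : ℤ) : (G.shift x).edge k = x.edge (k + 1) := rfl

theorem shift_symm_apply (x : G.Shift) (k : ℤ) : (G.shift.symm x).edge k = x.edge (k - 1) := rfl

/-! The edge shift of a finite graph is a Smale space. -/

instance instCompactSpaceShift [Finite E] : CompactSpace G.Shift := by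
  let _ : TopologicalSpace E := ⊥
  have : DiscreteTopology E := ⟨rfl⟩
  let S : Set (ℤ → E) := {e | ∀ k, G.t (e k) = G.i (e (k + 1))}
  have hS : IsClosed S := by
    have : S = ⋂ k, {e | G.t (e k) = G.i (e (k + 1))} := by ext; simp [S]
    rw [this]
    refine isClosed_iInter fun k => ?_
    exact (isClosed_discrete {p : E × E | G.t p.1 = G.i p.2}).preimage
      (f := fun e : ℤ → E => (e k, e (k + 1))) (by fun_prop)
  have hSc : CompactSpace S := isCompact_iff_compactSpace.1 hS.isCompact
  let f : S → G.Shift := fun e => ⟨e.1, e.2⟩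
  have hf : Continuous f := by
    refine continuous_iff_continuousAt.2 fun e => Metric.tendsto_nhds.2 fun ε hε => ?_
    obtain ⟨K, hK⟩ := exists_pow_lt_of_lt_one hε (by norm_num : (1 / 2 : ℝ) < 1)
    have hev : ∀ᶠ e' in 𝓝 e, ∀ k ∈ Finset.Icc (-(K : ℤ)) K, e'.1 k = e.1 k := by
      rw [Filter.eventually_all_finset]
      intro k _
      have hc : Continuous fun e' : S => e'.1 k := (continuous_apply k).comp continuous_subtype_val
      exact hc.continuousAt.eventually (by simp [nhds_discrete] : ∀ᶠ a in 𝓝 (e.1 k), a = e.1 k)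
    filter_upwards [hev] with e' he'
    have hA : Agree (f e') (f e) K :=
      ⟨congrArg G.t (he' 0 (by simp)),
        fun k h1 h2 => he' k (Finset.mem_Icc.2 ⟨by omega, by omega⟩)⟩
    exact (hA.dist_le.trans
      (pow_le_pow_of_le_one (by norm_num) (by norm_num) (Nat.le_succ K))).trans_lt hK
  have hsurj : Function.Surjective f := fun x => ⟨⟨x.edge, x.valid⟩, rfl⟩
  exact hsurj.compactSpace hf

open Classical in
/-- The bracket of two paths through the same vertex between the places `0` and `1`: the past of
`y` followed by the future of `x`. -/
def bracket (x y : G.Shift) : G.Shift :=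
  if h : G.t (x.edge 0) = G.t (y.edge 0) then
    ⟨fun k => if k ≤ 0 then y.edge k else x.edge k, fun k => by
      rcases lt_trichotomy k 0 with hk | rfl | hk
      · simp only [if_pos hk.le, if_pos (show k + 1 ≤ 0 by omega)]
        exact y.valid k
      · simp only [le_refl, if_true, if_neg (show ¬ ((0 : ℤ) + 1 ≤ 0) by omega)]
        rw [← h]
        exact x.valid 0
      · simp only [if_neg (show ¬ k ≤ 0 by omega), if_neg (show ¬ k + 1 ≤ 0 by omega)]
        exact x.valid k⟩
  else x

theorem bracket_apply {x y : G.Shift} (h : G.t (x.edge 0) = G.t (y.edge 0)) (k : ℤ) :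
    (bracket x y).edge k = if k ≤ 0 then y.edge k else x.edge k := by
  rw [bracket, dif_pos h]

theorem dist_quarter {x y : G.Shift} (h : dist x y ≤ 1 / 4) :
    G.t (x.edge 0) = G.t (y.edge 0) ∧ x.edge 1 = y.edge 1 := by
  have hA : Agree x y 1 := dist_le_pow_iff.1 (h.trans (by norm_num))
  exact ⟨hA.1, hA.2 1 (by norm_num) (by norm_num)⟩

theorem dist_le_half_mul {x y x' y' : G.Shift} (h0 : G.t (x'.edge 0) = G.t (y'.edge 0))
    (h : ∀ K, Agree x y K → Agree x' y' (K + 1)) : dist x' y' ≤ 1 / 2 * dist x y := by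
  have h2 : 2 * dist x' y' ≤ dist x y := by
    refine le_csInf (distSet_nonempty x y) ?_
    rintro r (rfl | ⟨K, hK, rfl⟩)
    · linarith [dist_le_half_iff.2 h0]
    · have := (h K hK).dist_le
      rw [pow_succ] at this
      linarith
  linarith

theorem isSmaleBracket_shift : IsSmaleBracket G.shift (1 / 4) (1 / 2) (bracket (G := G)) where
  continuousOn := by
    refine continuousOn_of_agree fun z hz K => ⟨(1 / 2) ^ K, by positivity, fun z' hz' h => ?_⟩
    have hz := (dist_quarter hz).1
    have hz' := (dist_quarter hz').1
    rw [Prod.dist_eq, max_lt_iff] at h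
    have h1 := agree_of_dist_lt h.1
    have h2 := agree_of_dist_lt h.2
    refine ⟨?_, fun k hk hk' => ?_⟩
    · simp only [bracket_apply hz, bracket_apply hz', le_refl, if_true]
      exact h2.1
    · simp only [bracket_apply hz, bracket_apply hz', h1.2 k hk hk', h2.2 k hk hk']
  b1 x := Shift.ext (funext fun k => by rw [bracket_apply rfl, ite_self])
  b2 x y z h1 h2 h3 := by
    refine Shift.ext (funext fun k => ?_)
    rw [bracket_apply (dist_quarter h2).1, bracket_apply (dist_quarter h3).1,
      bracket_apply (dist_quarter h1).1]
    split_ifs <;> rfl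
  b3 x y z h1 h2 h3 := by
    refine Shift.ext (funext fun k => ?_)
    rw [bracket_apply (dist_quarter h2).1, bracket_apply (dist_quarter h3).1,
      bracket_apply (dist_quarter h1).1]
    split_ifs <;> rfl
  b4 x y h1 h2 := by
    refine Shift.ext (funext fun k => ?_)
    rw [shift_apply, bracket_apply (dist_quarter h1).1, bracket_apply (dist_quarter h2).1,
      shift_apply, shift_apply]
    rcases lt_trichotomy k 0 with hk | rfl | hk
    · rw [if_pos (by omega), if_pos hk.le]
    · rw [if_neg (by omega), if_pos le_rfl]
      exact (dist_quarter h1).2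
    · rw [if_neg (by omega), if_neg (by omega)]
  c1 x y h hb := by
    have hxy : ∀ k : ℤ, 1 ≤ k → x.edge k = y.edge k := fun k hk => by
      rw [← hb, bracket_apply (dist_quarter h).1, if_neg (by omega)]
    have h1 : G.t ((G.shift x).edge 0) = G.t ((G.shift y).edge 0) :=
      congrArg G.t (hxy (0 + 1) (by omega))
    refine dist_le_half_mul h1 fun K hK => ⟨h1, fun k hk hk' => ?_⟩
    rw [shift_apply, shift_apply]
    rcases le_or_gt 1 (k + 1) with h' | h'
    · exact hxy _ h'
    · exact hK.2 _ (by push_cast at hk; omega) (by omega)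
  c2 x y h hb := by
    have hxy : ∀ k : ℤ, k ≤ 0 → x.edge k = y.edge k := fun k hk => by
      rw [← hb, bracket_apply (dist_quarter h).1, if_pos hk]
    have h1 : G.t ((G.shift.symm x).edge 0) = G.t ((G.shift.symm y).edge 0) :=
      congrArg G.t (hxy (0 - 1) (by omega))
    refine dist_le_half_mul h1 fun K hK => ⟨h1, fun k hk hk' => ?_⟩
    rw [shift_symm_apply, shift_symm_apply]
    rcases le_or_gt (k - 1) 0 with h' | h'
    · exact hxy _ h'
    · exact hK.2 _ (by omega) (by push_cast at hk'; omega)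

theorem isSmaleSpace_shift [Finite E] : IsSmaleSpace G.shift :=
  ⟨inferInstance, 1 / 4, 1 / 2, bracket, by norm_num, by norm_num, by norm_num,
    isSmaleBracket_shift⟩

end Graph

end SmaleCorr

end

/-! A finite-to-one factor map of compact systems preserves entropy. Fibres are finite, so over a
long dynamical ball of the base the orbits upstairs fall, for every `a > 0`, into at most `exp (a
n)` classes up to a constant factor (`exists_colouring`). Hence (1) gives (2).

The entropy of an irreducible edge shift is the logarithm of its Perron eigenvalue
(`entropy_shift`). If the entropies agree, the outer product of a positive right eigenvector of
`A_H` and a positive left eigenvector of `A_G` is a positive real solution of `F A_G = A_H F`. This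
linear system has integer coefficients, so it also has a positive rational solution
(`exists_nat_intertwiner`), and clearing denominators gives (3).

Given (3), read `F` as a set of arrows, `F w v` of them from `w` to `v`. The equation says that
paths "arrow, then edge of `G`" and paths "edge of `H`, then arrow" with the same ends are
equinumerous. A choice of bijections between them gives commuting squares; these are the edges of a
graph whose vertices are the arrows. This graph covers `G` forwards and `H` backwards, so its edge
shift is a correspondence (`existsCorrespondence_of_intertwiner`).

The same space also witnesses (1), because an s- or u-bijective map from a Smale space to an
expansive system is finite-to-one. The bracket of two close points of a fibre has the same image as
both, by expansiveness, so injectivity on stable sets puts the two points in one local unstable set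
(`exists_fibre_contraction`). By compactness only finitely many points can be related in this way.
-/

namespace SmaleCorr

/-! ### A Perron-Frobenius theorem -/

/-- A nonnegative irreducible matrix has a positive eigenvector. The eigenvalue maximizes `r`
subject to `r x ≤ A x` with `x` in the standard simplex. -/
theorem exists_pos_eigenvector {n : Type*} [Fintype n] [DecidableEq n] [Nonempty n]
    {A : Matrix n n ℝ} (hA : ∀ i j, 0 ≤ A i j) (hirr : ∀ i j, ∃ k, 0 < (A ^ k) i j) :
    ∃ (r : ℝ) (x : n → ℝ), (∀ i, 0 < x i) ∧ A.mulVec x = r • x := by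
  classical
  choose k hk using hirr
  have hAk : ∀ (m : ℕ) i j, 0 ≤ (A ^ m) i j := fun m i j => Matrix.pow_apply_nonneg hA m i j
  -- One bound for all exponents makes the finite sum `P` of powers entrywise positive. It commutes
  -- with `A` and turns nonzero nonnegative vectors into positive ones.
  obtain ⟨N, hN⟩ : ∃ N, ∀ i j, k i j < N := by
    refine ⟨(∑ i, ∑ j, k i j) + 1, fun i j => Nat.lt_succ_of_le ?_⟩
    exact (Finset.single_le_sum (f := fun j => k i j) (fun _ _ => Nat.zero_le _)
      (Finset.mem_univ j)).trans (Finset.single_le_sum (f := fun i => ∑ j, k i j)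
      (fun _ _ => Nat.zero_le _) (Finset.mem_univ i))
  set P : Matrix n n ℝ := ∑ m ∈ Finset.range N, A ^ m with hPdef
  have hP : ∀ i j, 0 < P i j := by
    intro i j
    rw [hPdef, Matrix.sum_apply]
    exact Finset.sum_pos' (fun m _ => hAk m i j) ⟨k i j, Finset.mem_range.2 (hN i j), hk i j⟩
  have hPv : ∀ x : n → ℝ, (∀ i, 0 ≤ x i) → (∃ i, x i ≠ 0) → ∀ i, 0 < P.mulVec x i := by
    rintro x hx ⟨j, hj⟩ i
    exact Finset.sum_pos' (fun l _ => mul_nonneg (hP i l).le (hx l))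
      ⟨j, Finset.mem_univ j, mul_pos (hP i j) (lt_of_le_of_ne (hx j) (Ne.symm hj))⟩
  set C : ℝ := ∑ i, ∑ j, A i j with hC
  let S : Set ((n → ℝ) × ℝ) := {p | p.1 ∈ stdSimplex ℝ n ∧ p.2 ∈ Set.Icc 0 C ∧
    ∀ i, p.2 * p.1 i ≤ A.mulVec p.1 i}
  have hSc : IsCompact S := by
    have h1 : IsCompact (stdSimplex ℝ n ×ˢ Set.Icc (0 : ℝ) C) :=
      (isCompact_stdSimplex ℝ n).prod isCompact_Icc
    have h2 : IsClosed {p : (n → ℝ) × ℝ | ∀ i, p.2 * p.1 i ≤ A.mulVec p.1 i} := by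
      simp only [Set.ofPred_forall, Matrix.mulVec, dotProduct]
      refine isClosed_iInter fun i => isClosed_le (by fun_prop) (by fun_prop)
    convert h1.inter_right h2 using 1
    ext p
    simp [S, and_assoc]
  have hle : ∀ (x : n → ℝ) (r : ℝ), x ∈ stdSimplex ℝ n → (∀ i, r * x i ≤ A.mulVec x i) →
      r ≤ C := by
    intro x r hx h
    have h1 : ∑ i, r * x i ≤ ∑ i, A.mulVec x i := Finset.sum_le_sum fun i _ => h i
    rw [← Finset.mul_sum, hx.2, mul_one] at h1
    refine h1.trans (Finset.sum_le_sum fun i _ => Finset.sum_le_sum fun j _ => ?_)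
    exact mul_le_of_le_one_right (hA i j)
      (hx.2 ▸ Finset.single_le_sum (fun l _ => hx.1 l) (Finset.mem_univ j))
  have hmv : ∀ x : n → ℝ, (∀ i, 0 ≤ x i) → ∀ i, 0 ≤ A.mulVec x i := fun x hx i =>
    Finset.sum_nonneg fun j _ => mul_nonneg (hA i j) (hx j)
  have hSne : S.Nonempty := by
    obtain ⟨i₀⟩ := ‹Nonempty n›
    refine ⟨(Pi.single i₀ 1, 0), single_mem_stdSimplex ℝ i₀, ⟨le_rfl, ?_⟩, fun i => ?_⟩
    · exact Finset.sum_nonneg fun i _ => Finset.sum_nonneg fun j _ => hA i j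
    · rw [zero_mul]
      exact hmv _ (single_mem_stdSimplex ℝ i₀).1 i
  obtain ⟨⟨x, r⟩, ⟨hx, ⟨hr0, -⟩, hrx⟩, hmax⟩ := hSc.exists_isMaxOn hSne continuous_snd.continuousOn
  have hxne : ∃ i, x i ≠ 0 := by
    by_contra! h
    have := hx.2
    simp [h] at this
  have heq : A.mulVec x = r • x := by
    -- Applying `P` to the nonzero slack `A x - r x` makes it positive in every coordinate. Then `P
    -- x`, normalized, admits a rate larger than `r`, against maximality.
    by_contra hne
    have hd0 : ∀ i, 0 ≤ (A.mulVec x - r • x) i := fun i => sub_nonneg.2 (hrx i)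
    have hdne : ∃ i, (A.mulVec x - r • x) i ≠ 0 := by
      by_contra! h
      exact hne (sub_eq_zero.1 (funext h))
    have hPd := hPv _ hd0 hdne
    have hy := hPv x hx.1 hxne
    set y := P.mulVec x with hydef
    have hcomm : A * P = P * A := by
      rw [hPdef, Finset.mul_sum, Finset.sum_mul]
      exact Finset.sum_congr rfl fun m _ => (Commute.self_pow A m).eq
    have hAy : A.mulVec y = r • y + P.mulVec (A.mulVec x - r • x) := by
      rw [hydef, Matrix.mulVec_sub, Matrix.mulVec_smul, Matrix.mulVec_mulVec,
        Matrix.mulVec_mulVec, hcomm]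
      abel
    obtain ⟨e, he, hey⟩ : ∃ e > 0, ∀ i, e * y i ≤ P.mulVec (A.mulVec x - r • x) i := by
      obtain ⟨i₀, -, hi₀⟩ := Finset.exists_min_image Finset.univ
        (fun i => P.mulVec (A.mulVec x - r • x) i / y i) Finset.univ_nonempty
      exact ⟨_, div_pos (hPd i₀) (hy i₀), fun i =>
        (le_div_iff₀ (hy i)).1 (hi₀ i (Finset.mem_univ i))⟩
    set s := ∑ i, y i with hs
    have hspos : 0 < s := Finset.sum_pos (fun i _ => hy i) Finset.univ_nonempty
    have hzx : s⁻¹ • y ∈ stdSimplex ℝ n := by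
      refine ⟨fun i => mul_nonneg (inv_pos.2 hspos).le (hy i).le, ?_⟩
      simp only [Pi.smul_apply, smul_eq_mul, ← Finset.mul_sum, ← hs]
      exact inv_mul_cancel₀ hspos.ne'
    have hz : ∀ i, (r + e) * (s⁻¹ • y) i ≤ A.mulVec (s⁻¹ • y) i := by
      intro i
      rw [Matrix.mulVec_smul, hAy]
      simp only [Pi.smul_apply, smul_eq_mul, Pi.add_apply]
      have h1 : (r + e) * y i ≤ r * y i + P.mulVec (A.mulVec x - r • x) i := by
        linarith [hey i]
      calc (r + e) * (s⁻¹ * y i) = s⁻¹ * ((r + e) * y i) := by ring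
        _ ≤ _ := mul_le_mul_of_nonneg_left h1 (inv_pos.2 hspos).le
    have h2 : r + e ≤ r := hmax (show (s⁻¹ • y, r + e) ∈ S from
      ⟨hzx, ⟨by positivity, hle _ _ hzx hz⟩, hz⟩)
    linarith
  refine ⟨r, x, fun i => ?_, heq⟩
  have hpow : ∀ m : ℕ, (A ^ m).mulVec x = r ^ m • x := by
    intro m
    induction m with
    | zero => simp
    | succ m ih =>
      rw [pow_succ, ← Matrix.mulVec_mulVec, heq, Matrix.mulVec_smul, ih, smul_smul, pow_succ,
        mul_comm]
  have hPx : P.mulVec x = (∑ m ∈ Finset.range N, r ^ m) • x := by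
    rw [hPdef, Matrix.sum_mulVec, Finset.sum_smul]
    exact Finset.sum_congr rfl fun m _ => hpow m
  have h := hPv x hx.1 hxne i
  rw [hPx, Pi.smul_apply, smul_eq_mul] at h
  exact pos_of_mul_pos_right h (Finset.sum_nonneg fun m _ => pow_nonneg hr0 m)

/-! ### Resolving maps onto expansive systems are finite-to-one -/

section Resolving

variable {X : Type u} [MetricSpace X] {Y : Type v} [MetricSpace Y]

/-- Exchanging the arguments of a bracket gives a bracket for the inverse homeomorphism. -/
theorem IsSmaleBracket.swap {φ : X ≃ₜ X} {ε l : ℝ} {br : X → X → X}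
    (h : IsSmaleBracket φ ε l br) : IsSmaleBracket φ.symm ε l fun x y => br y x where
  continuousOn := h.continuousOn.comp continuous_swap.continuousOn fun p hp => by
    change dist p.2 p.1 ≤ ε
    rwa [dist_comm]
  b1 := h.b1
  b2 x y z h1 h2 h3 := h.b3 z y x (by rwa [dist_comm]) (by rwa [dist_comm]) (by rwa [dist_comm])
  b3 x y z h1 h2 h3 := h.b2 z y x (by rwa [dist_comm]) (by rwa [dist_comm]) (by rwa [dist_comm])
  b4 x y h1 h2 := by
    rw [φ.symm_apply_eq, h.b4 _ _ (by rwa [dist_comm])]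
    · simp
    · simpa [dist_comm] using h1
  c1 x y h1 h2 := by
    rw [dist_comm (φ.symm x), dist_comm x]
    exact h.c2 y x (by rwa [dist_comm]) h2
  c2 x y h1 h2 := by
    rw [Homeomorph.symm_symm, dist_comm (φ x), dist_comm x]
    exact h.c1 y x (by rwa [dist_comm]) h2

theorem IsSmaleSpace.symm {φ : X ≃ₜ X} (h : IsSmaleSpace φ) : IsSmaleSpace φ.symm := by
  obtain ⟨hc, ε, l, br, h0, h1, h2, hb⟩ := h
  exact ⟨hc, ε, l, _, h0, h1, h2, hb.swap⟩

/-- Contraction keeps the pair within `ε`, so `b4` carries the bracket relation to the next iterate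
and `c1` applies again. -/
theorem IsSmaleBracket.iterate_of_stable {φ : X ≃ₜ X} {ε l : ℝ} {br : X → X → X}
    (h : IsSmaleBracket φ ε l br) (hl0 : 0 < l) (hl1 : l < 1) {x y : X} (hxy : dist x y ≤ ε)
    (hb : br x y = y) (n : ℕ) :
    dist (φ^[n] x) (φ^[n] y) ≤ l ^ n * dist x y ∧ br (φ^[n] x) (φ^[n] y) = φ^[n] y := by
  induction n with
  | zero => simpa using hb
  | succ n ih =>
    obtain ⟨hd, hbn⟩ := ih
    have h1 : dist (φ^[n] x) (φ^[n] y) ≤ ε := hd.trans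
      ((mul_le_of_le_one_left dist_nonneg (pow_le_one₀ hl0.le hl1.le)).trans hxy)
    have h2 := h.c1 _ _ h1 hbn
    simp only [Function.iterate_succ_apply']
    constructor
    · rw [pow_succ, mul_comm (l ^ n), mul_assoc]
      exact h2.trans (mul_le_mul_of_nonneg_left hd hl0.le)
    · rw [← h.b4 _ _ h1 (h2.trans ((mul_le_of_le_one_left dist_nonneg hl1.le).trans h1)), hbn]

theorem IsSmaleBracket.iterate_of_unstable {φ : X ≃ₜ X} {ε l : ℝ} {br : X → X → X}
    (h : IsSmaleBracket φ ε l br) (hl0 : 0 < l) (hl1 : l < 1) {x y : X} (hxy : dist x y ≤ ε)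
    (hb : br x y = x) (n : ℕ) :
    dist (φ.symm^[n] x) (φ.symm^[n] y) ≤ l ^ n * dist x y := by
  rw [dist_comm (φ.symm^[n] x), dist_comm x]
  exact (h.swap.iterate_of_stable hl0 hl1 (by rwa [dist_comm]) hb n).1

/-- Two points whose orbits stay `c`-close in the past and in the future coincide. -/
def IsExpansive (φ : X ≃ₜ X) (c : ℝ) : Prop :=
  ∀ x y, (∀ n : ℕ, dist (φ^[n] x) (φ^[n] y) ≤ c) →
    (∀ n : ℕ, dist (φ.symm^[n] x) (φ.symm^[n] y) ≤ c) → x = y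

theorem IsExpansive.symm {φ : X ≃ₜ X} {c : ℝ} (h : IsExpansive φ c) : IsExpansive φ.symm c :=
  fun x y h1 h2 => h x y h2 h1

theorem semiconj_symm {ψ : Y ≃ₜ Y} {φ : X ≃ₜ X} {π : Y → X} (h : Function.Semiconj π ψ φ) :
    Function.Semiconj π ψ.symm φ.symm := fun y => by
  rw [φ.eq_symm_apply, ← h.eq, ψ.apply_symm_apply]

/-- If `π` is injective on stable sets and the image is expansive, then nearby points of a fibre
lie in the same local unstable set. -/
theorem exists_fibre_contraction {ψ : Y ≃ₜ Y} {φ : X ≃ₜ X} {π : Y → X} {c : ℝ}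
    (hψ : IsSmaleSpace ψ) (hc0 : 0 < c) (hc : IsExpansive φ c) (hπ : Continuous π)
    (hsemi : Function.Semiconj π ψ φ) (hinj : ∀ y, Set.InjOn π (stableSet ψ y)) :
    ∃ δ l : ℝ, 0 < δ ∧ 0 < l ∧ l < 1 ∧ ∀ y y', π y = π y' → dist y y' ≤ δ →
      dist (ψ.symm y) (ψ.symm y') ≤ l * dist y y' := by
  obtain ⟨hY, ε, l, br, hε, hl0, hl1, hb⟩ := hψ
  obtain ⟨η, hη, hπu⟩ := Metric.uniformContinuous_iff.1
    (CompactSpace.uniformContinuous_of_continuous hπ) c hc0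
  have hK : IsCompact {p : Y × Y | dist p.1 p.2 ≤ ε} :=
    (isClosed_le continuous_dist continuous_const).isCompact
  obtain ⟨δ, hδ, hu⟩ := Metric.uniformContinuousOn_iff.1
    (hK.uniformContinuousOn_of_continuous hb.continuousOn) (min ε η / 2) (by positivity)
  have hmin0 : 0 < min ε η := by positivity
  -- The halves make `z = [y, y']` closer than `min ε η` to both points: within `ε` the bracket
  -- identities apply, and within `η` the images stay `c`-close.
  refine ⟨min (δ / 2) (min ε η / 2), l, by positivity, hl0, hl1, fun y y' hyy hd => ?_⟩
  have hd1 : dist y y' < δ := by linarith [hd.trans (min_le_left _ _)]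
  have hd2 : dist y y' ≤ min ε η / 2 := hd.trans (min_le_right _ _)
  have hdε : dist y y' ≤ ε := by linarith [min_le_left ε η]
  set z := br y y' with hz
  have hzy' : dist z y' < min ε η / 2 := by
    have := hu (y, y') hdε (y', y') (by simpa using hε.le) (by simpa [Prod.dist_eq] using hd1)
    simpa [hb.b1] using this
  have hyz : dist y z < min ε η := by
    linarith [dist_triangle y y' z, dist_comm z y']
  have hyzε : dist y z ≤ ε := hyz.le.trans (min_le_left _ _)
  have hzyε : dist z y' ≤ ε := by linarith [min_le_left ε η]
  have hbs : br y z = z := hb.b2 _ _ _ hdε hyzε hdε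
  have hbu : br z y' = z := hb.b3 _ _ _ hdε hzyε hdε
  have hs := fun n => (hb.iterate_of_stable hl0 hl1 hyzε hbs n).1
  have hun := hb.iterate_of_unstable hl0 hl1 hzyε hbu
  have hshrink : ∀ (n : ℕ) (d : ℝ), 0 ≤ d → d < η → l ^ n * d < η := fun n d h0 h1 =>
    (mul_le_of_le_one_left h0 (pow_le_one₀ hl0.le hl1.le)).trans_lt h1
  -- The point `z` follows `y` in the future and `y'` in the past. Downstairs these two have the
  -- same orbit, so expansiveness applies.
  have hπz : π y = π z := by
    refine hc _ _ (fun n => ?_) (fun n => ?_)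
    · rw [← (hsemi.iterate_right n).eq, ← (hsemi.iterate_right n).eq]
      exact (hπu ((hs n).trans_lt
        (hshrink n _ dist_nonneg (hyz.trans_le (min_le_right _ _))))).le
    · rw [hyy, ← ((semiconj_symm hsemi).iterate_right n).eq,
        ← ((semiconj_symm hsemi).iterate_right n).eq, dist_comm]
      exact (hπu ((hun n).trans_lt
        (hshrink n _ dist_nonneg (by linarith [min_le_right ε η])))).le
  have hzs : z ∈ stableSet ψ y := by
    refine squeeze_zero (fun _ => dist_nonneg) hs ?_
    simpa using (tendsto_pow_atTop_nhds_zero_of_lt_one hl0.le hl1).mul_const (dist y z)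
  have hys : y ∈ stableSet ψ y := by simp [stableSet]
  have hyz' : y = z := hinj y hys hzs hπz
  exact hb.c2 y y' hdε (by rw [← hz, ← hyz'])

/-- A system with a contraction property on the fibres of a map has finite fibres: finitely many
points of a fibre are uniformly separated by some iterate. -/
theorem finiteToOne_of_fibre_contraction [CompactSpace Y] {ψ : Y ≃ₜ Y} {φ : X ≃ₜ X} {π : Y → X}
    (hsemi : Function.Semiconj π ψ φ) {δ l : ℝ} (hδ : 0 < δ) (hl0 : 0 < l) (hl1 : l < 1)
    (h : ∀ y y', π y = π y' → dist y y' ≤ δ → dist (ψ.symm y) (ψ.symm y') ≤ l * dist y y') :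
    FiniteToOne π := by
  have hback : ∀ (n : ℕ) y y', π y = π y' → dist (ψ^[n] y) (ψ^[n] y') ≤ δ →
      dist y y' ≤ l ^ n * δ := by
    intro n
    induction n with
    | zero => intro y y' _ hd; simpa using hd
    | succ n ih =>
      intro y y' hyy hd
      have h0 : π (ψ y) = π (ψ y') := by rw [hsemi.eq, hsemi.eq, hyy]
      have h1 := ih (ψ y) (ψ y') h0 (by simpa using hd)
      have h2 := h _ _ h0 (h1.trans (mul_le_of_le_one_left hδ.le (pow_le_one₀ hl0.le hl1.le)))
      rw [ψ.symm_apply_apply, ψ.symm_apply_apply] at h2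
      rw [pow_succ, mul_comm (l ^ n), mul_assoc]
      exact h2.trans (mul_le_mul_of_nonneg_left h1 hl0.le)
  obtain ⟨t, htf, ht⟩ := (Metric.totallyBounded_iff.1 (isCompact_univ (X := Y)).totallyBounded)
    (δ / 2) (by positivity)
  intro b
  by_contra hinf
  obtain ⟨s, hs, hcard⟩ := Set.Infinite.exists_subset_card_eq hinf (htf.toFinset.card + 1)
  -- By `hback`, a pair still `δ`-close at time `n` started within `l ^ n * δ`. So one late time
  -- separates all the finitely many pairs, which a `δ / 2`-net of fewer points forbids.
  have hev : ∀ᶠ n : ℕ in atTop, ∀ p ∈ s ×ˢ s, p.1 ≠ p.2 → δ < dist (ψ^[n] p.1) (ψ^[n] p.2) := by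
    rw [Filter.eventually_all_finset]
    intro p hp
    by_cases hne : p.1 = p.2
    · exact Eventually.of_forall fun n hn => absurd hne hn
    have hpos : 0 < dist p.1 p.2 := dist_pos.2 hne
    have hlim : Tendsto (fun n : ℕ => l ^ n * δ) atTop (𝓝 0) := by
      simpa using (tendsto_pow_atTop_nhds_zero_of_lt_one hl0.le hl1).mul_const δ
    filter_upwards [hlim.eventually_lt_const hpos] with n hn _
    by_contra! hle
    rw [Finset.mem_product] at hp
    have h1 : π p.1 = b := hs hp.1
    have h2 : π p.2 = b := hs hp.2
    exact absurd (hback n _ _ (h1.trans h2.symm) hle) (not_le.2 hn)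
  obtain ⟨n, hn⟩ := hev.exists
  have hcov : ∀ y : Y, ∃ a ∈ t, dist (ψ^[n] y) a < δ / 2 := fun y => by
    simpa using ht (Set.mem_univ (ψ^[n] y))
  choose a hat had using hcov
  have hcardle : s.card ≤ htf.toFinset.card := by
    refine Finset.card_le_card_of_injOn a (fun y _ => by simpa using hat y) fun y hy y' hy' he => ?_
    by_contra hne
    have h1 := hn (y, y') (Finset.mk_mem_product hy hy') hne
    have h2 := had y
    have h3 := had y'
    rw [← he] at h3
    linarith [dist_triangle_right (ψ^[n] y) (ψ^[n] y') (a y)]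
  omega

theorem IsSBijective.finiteToOne {ψ : Y ≃ₜ Y} {φ : X ≃ₜ X} {π : Y → X} {c : ℝ}
    (h : IsSBijective ψ φ π) (hψ : IsSmaleSpace ψ) (hc0 : 0 < c) (hc : IsExpansive φ c) :
    FiniteToOne π := by
  obtain ⟨δ, l, h0, h1, h2, h3⟩ := exists_fibre_contraction hψ hc0 hc h.continuous h.semiconj
    fun y => (h.bijOn y).injOn
  have := hψ.compact
  exact finiteToOne_of_fibre_contraction h.semiconj h0 h1 h2 h3

/-- Time reversal: unstable sets are the stable sets of the inverse. -/
theorem IsUBijective.finiteToOne {ψ : Y ≃ₜ Y} {φ : X ≃ₜ X} {π : Y → X} {c : ℝ}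
    (h : IsUBijective ψ φ π) (hψ : IsSmaleSpace ψ) (hc0 : 0 < c) (hc : IsExpansive φ c) :
    FiniteToOne π :=
  IsSBijective.finiteToOne ⟨⟨h.continuous, semiconj_symm h.semiconj, h.surjective⟩, h.bijOn⟩
    hψ.symm hc0 hc.symm

end Resolving

/-! ### Expansiveness of edge shifts -/

namespace Graph

variable {V : Type u} {E : Type v} {G : Graph V E}

theorem shift_iterate_edge (x : G.Shift) (n : ℕ) (k : ℤ) :
    (G.shift^[n] x).edge k = x.edge (k + n) := by
  induction n generalizing k with
  | zero => simp
  | succ n ih =>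
    rw [Function.iterate_succ_apply', shift_apply, ih]
    congr 1
    push_cast
    ring

theorem shift_symm_iterate_edge (x : G.Shift) (n : ℕ) (k : ℤ) :
    (G.shift.symm^[n] x).edge k = x.edge (k - n) := by
  induction n generalizing k with
  | zero => simp
  | succ n ih =>
    rw [Function.iterate_succ_apply', shift_symm_apply, ih]
    congr 1
    push_cast
    ring

/-- Distance at most `1 / 4` fixes the edge at place `1`; the forward and backward iterates move
every other edge to that place. -/
theorem isExpansive_shift : IsExpansive G.shift (1 / 4) := by
  intro x y h1 h2
  refine Shift.ext (funext fun k => ?_)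
  rcases le_total 1 k with hk | hk
  · have := (dist_quarter (h1 (k - 1).toNat)).2
    rw [shift_iterate_edge, shift_iterate_edge] at this
    rwa [show (1 : ℤ) + ((k - 1).toNat : ℤ) = k by omega] at this
  · have := (dist_quarter (h2 (1 - k).toNat)).2
    rw [shift_symm_iterate_edge, shift_symm_iterate_edge] at this
    rwa [show (1 : ℤ) - ((1 - k).toNat : ℤ) = k by omega] at this

end Graph

/-! ### Finite-to-one factor maps preserve entropy -/

section Bowen

variable {X : Type u} [MetricSpace X] {Y : Type v} [MetricSpace Y]

/-- Near every point of the base, the fibres of a finite-to-one map are covered for a bounded time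
`k` by at most `exp (a k)` dynamical cells of small diameter. -/
theorem exists_local_colouring [CompactSpace X] [CompactSpace Y] {ψ : Y ≃ₜ Y} {π : Y → X}
    (hπ : Continuous π) (hfin : FiniteToOne π) {a ε : ℝ} (ha : 0 < a) (hε : 0 < ε) :
    ∃ (N : ℕ) (δ : ℝ), 0 < δ ∧ ∀ x : X, ∃ k : ℕ, 0 < k ∧ k ≤ N ∧ ∃ m : ℕ,
      (m : ℝ) ≤ Real.exp (a * k) ∧ ∃ c : Y → Fin m, ∀ u u', dist (π u) x < δ →
        dist (π u') x < δ → c u = c u' → ∀ j < k, dist (ψ^[j] u) (ψ^[j] u') < ε := by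
  classical
  -- The time is long enough for the whole fibre to cost at most `exp (a k)`. The extra `1` pays for
  -- a default colour.
  have hk : ∀ x : X, ∃ k : ℕ, 0 < k ∧ (((π ⁻¹' {x}).ncard + 1 : ℕ) : ℝ) ≤ Real.exp (a * k) := by
    intro x
    have ht : Tendsto (fun k : ℕ => Real.exp (a * k)) atTop atTop :=
      Real.tendsto_exp_atTop.comp ((tendsto_natCast_atTop_atTop).const_mul_atTop ha)
    exact ((eventually_gt_atTop 0).and (ht.eventually_ge_atTop _)).exists
  choose k hk0 hk using hk
  let U : X → Set Y := fun x => ⋃ p ∈ π ⁻¹' {x}, {u | ∀ j < k x, dist (ψ^[j] u) (ψ^[j] p) < ε / 2}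
  have hU : ∀ x, IsOpen (U x) := fun x => isOpen_biUnion fun p _ => by
    have : {u | ∀ j < k x, dist (ψ^[j] u) (ψ^[j] p) < ε / 2} =
        ⋂ j ∈ Finset.range (k x), {u | dist (ψ^[j] u) (ψ^[j] p) < ε / 2} := by ext; simp
    rw [this]
    exact isOpen_biInter_finset fun j _ =>
      isOpen_lt ((ψ.continuous.iterate j).dist continuous_const) continuous_const
  -- These are the points whose entire fibre lies in `U x`; the set is open because `π` is a closed
  -- map.
  let W : X → Set X := fun x => (π '' (U x)ᶜ)ᶜ
  have hW : ∀ x, IsOpen (W x) := fun x =>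
    ((hU x).isClosed_compl.isCompact.image hπ).isClosed.isOpen_compl
  have hxW : ∀ x, x ∈ W x := by
    rintro x ⟨u, hu, rfl⟩
    exact hu (Set.mem_biUnion (x := u) rfl fun j _ => by simpa using hε)
  have hWU : ∀ x u, π u ∈ W x → u ∈ U x := fun x u h => by
    by_contra hu
    exact h ⟨u, hu, rfl⟩
  obtain ⟨t, ht⟩ := isCompact_univ.elim_finite_subcover W hW fun x _ =>
    Set.mem_iUnion.2 ⟨x, hxW x⟩
  obtain ⟨δ, hδ, hL⟩ := lebesgue_number_lemma_of_metric (isCompact_univ (X := X))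
    (c := fun i : t => W i) (fun i => hW i) fun x hx => by simpa using ht hx
  refine ⟨t.sup k, δ, hδ, fun x => ?_⟩
  obtain ⟨i, hi⟩ := hL x trivial
  refine ⟨k i, hk0 i, Finset.le_sup i.2, _, hk i, ?_⟩
  have hF := hfin i
  have hcU : ∀ u, ∃ p, u ∈ U i →
      p ∈ π ⁻¹' {i.1} ∧ ∀ j < k i, dist (ψ^[j] u) (ψ^[j] p) < ε / 2 := by
    intro u
    by_cases hu : u ∈ U i
    · obtain ⟨p, hp, h⟩ := Set.mem_iUnion₂.1 hu
      exact ⟨p, fun _ => ⟨hp, h⟩⟩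
    · exact ⟨u, fun h => absurd h hu⟩
  choose p hp using hcU
  have hcard : Nat.card (π ⁻¹' {i.1}) = (π ⁻¹' {i.1}).ncard := rfl
  have := hF.to_subtype
  let e : (π ⁻¹' {i.1}) ≃ Fin (π ⁻¹' {i.1}).ncard := Finite.equivFinOfCardEq hcard
  -- The colour of `u` is the fibre point that it shadows up to time `k i`. The last colour is a
  -- default, never met over the ball in question.
  refine ⟨fun u => if h : p u ∈ π ⁻¹' {i.1} then (e ⟨p u, h⟩).castSucc else Fin.last _, ?_⟩
  intro u u' hu hu' hc j hj
  have h1 := hp u (hWU _ _ (hi hu))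
  have h2 := hp u' (hWU _ _ (hi hu'))
  simp only [dif_pos h1.1, dif_pos h2.1, Fin.castSucc_inj, e.apply_eq_iff_eq,
    Subtype.mk.injEq] at hc
  have h3 := h1.2 j hj
  have h4 := h2.2 j hj
  rw [← hc] at h4
  linarith [dist_triangle_right (ψ^[j] u) (ψ^[j] u') (ψ^[j] (p u))]

/-- The preimage of a dynamical ball under a finite-to-one map is covered by subexponentially many
dynamical cells of small diameter. -/
theorem exists_colouring [CompactSpace X] [CompactSpace Y] {ψ : Y ≃ₜ Y} {φ : X ≃ₜ X} {π : Y → X}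
    (hπ : Continuous π) (hsemi : Function.Semiconj π ψ φ) (hfin : FiniteToOne π) {a ε : ℝ}
    (ha : 0 < a) (hε : 0 < ε) :
    ∃ (N : ℕ) (δ : ℝ), 0 < δ ∧ ∀ (n : ℕ) (x : X), ∃ m : ℕ,
      (m : ℝ) ≤ Real.exp (a * (n + N)) ∧ ∃ c : Y → Fin m, ∀ u u',
        (∀ j < n, dist (φ^[j] (π u)) (φ^[j] x) < δ) →
        (∀ j < n, dist (φ^[j] (π u')) (φ^[j] x) < δ) → c u = c u' →
        ∀ j < n, dist (ψ^[j] u) (ψ^[j] u') < ε := by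
  obtain ⟨N, δ, hδ, hloc⟩ := exists_local_colouring (ψ := ψ) hπ hfin ha hε
  refine ⟨N, δ, hδ, fun n => ?_⟩
  -- Local colourings are concatenated along the orbit of `x`: a block of length `k` costs `exp (a
  -- k)` and leaves time `n - k`. Only the final block may overshoot `n`, and by at most `N`.
  induction n using Nat.strong_induction_on with
  | _ n ih =>
  intro x
  rcases Nat.eq_zero_or_pos n with rfl | hn
  · exact ⟨1, by simpa using by positivity, fun _ => 0, fun _ _ _ _ _ j hj => absurd hj (by omega)⟩
  obtain ⟨k, hk0, hkN, m, hm, c, hc⟩ := hloc x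
  rcases le_or_gt n k with hnk | hkn
  · refine ⟨m, hm.trans (Real.exp_le_exp.2 (mul_le_mul_of_nonneg_left ?_ ha.le)), c, ?_⟩
    · have : (k : ℝ) ≤ N := by exact_mod_cast hkN
      have : (0 : ℝ) ≤ n := Nat.cast_nonneg n
      linarith
    · intro u u' hu hu' hcu j hj
      exact hc u u' (by simpa using hu 0 hn) (by simpa using hu' 0 hn) hcu j (hj.trans_le hnk)
  · obtain ⟨q, rfl⟩ := Nat.exists_eq_add_of_le hkn.le
    obtain ⟨m', hm', c', hc'⟩ := ih q (by omega) (φ^[k] x)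
    refine ⟨m * m', ?_, fun u => finProdFinEquiv (c u, c' (ψ^[k] u)), ?_⟩
    · push_cast
      calc (m : ℝ) * m' ≤ Real.exp (a * k) * Real.exp (a * (q + N)) :=
            mul_le_mul hm hm' (Nat.cast_nonneg _) (Real.exp_pos _).le
        _ = _ := by rw [← Real.exp_add]; ring_nf
    · intro u u' hu hu' hcu j hj
      rw [finProdFinEquiv.apply_eq_iff_eq, Prod.mk.injEq] at hcu
      rcases lt_or_ge j k with hjk | hjk
      · exact hc u u' (by simpa using hu 0 hn) (by simpa using hu' 0 hn) hcu.1 j hjk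
      · obtain ⟨i, rfl⟩ := Nat.exists_eq_add_of_le' hjk
        have hshift : ∀ v, (∀ j < k + q, dist (φ^[j] (π v)) (φ^[j] x) < δ) →
            ∀ j < q, dist (φ^[j] (π (ψ^[k] v))) (φ^[j] (φ^[k] x)) < δ := fun v hv j hj => by
          rw [(hsemi.iterate_right k).eq, ← Function.iterate_add_apply,
            ← Function.iterate_add_apply]
          exact hv (j + k) (by omega)
        rw [Function.iterate_add_apply, Function.iterate_add_apply]
        exact hc' _ _ (hshift u hu) (hshift u' hu') hcu.2 i (by omega)

/-- One representative of each nonempty colour class over each centre in `s` gives a dynamical cover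
upstairs. -/
theorem coverMincard_le_of_colouring {ψ : Y ≃ₜ Y} {φ : X ≃ₜ X} {π : Y → X} {n : ℕ} {δ ε B : ℝ}
    (hcol : ∀ x : X, ∃ m : ℕ, (m : ℝ) ≤ B ∧ ∃ c : Y → Fin m, ∀ u u',
        (∀ j < n, dist (φ^[j] (π u)) (φ^[j] x) < δ) →
        (∀ j < n, dist (φ^[j] (π u')) (φ^[j] x) < δ) → c u = c u' →
        ∀ j < n, dist (ψ^[j] u) (ψ^[j] u') < ε) {s : Finset X}
    (hs : Dynamics.IsDynCoverOf φ Set.univ {p | dist p.1 p.2 < δ} n (s : Set X)) :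
    (Dynamics.coverMincard ψ Set.univ {p | dist p.1 p.2 < ε} n : ENNReal) ≤
      ENNReal.ofReal B * s.card := by
  classical
  rcases isEmpty_or_nonempty Y with hY | ⟨⟨y₀⟩⟩
  · rw [Set.univ_eq_empty_iff.2 hY]
    simp
  choose m hm c hc using hcol
  let S : X → Set Y := fun x => {u | ∀ j < n, dist (φ^[j] (π u)) (φ^[j] x) < δ}
  have hrep : ∀ x (i : Fin (m x)), ∃ r, ∀ u ∈ S x, c x u = i → r ∈ S x ∧ c x r = i := by
    intro x i
    by_cases h : ∃ u ∈ S x, c x u = i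
    · obtain ⟨u, hu, hi⟩ := h
      exact ⟨u, fun _ _ _ => ⟨hu, hi⟩⟩
    · exact ⟨y₀, fun u hu hi => absurd ⟨u, hu, hi⟩ h⟩
  choose r hr using hrep
  let T : Finset Y := s.biUnion fun x => Finset.univ.image (r x)
  have hT : Dynamics.IsDynCoverOf ψ Set.univ {p | dist p.1 p.2 < ε} n (T : Set Y) := by
    intro u _
    obtain ⟨x, hx, hux⟩ := hs (Set.mem_univ (π u))
    have hu : u ∈ S x := Dynamics.mem_dynEntourage.1 hux
    obtain ⟨h1, h2⟩ := hr x (c x u) u hu rfl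
    refine ⟨r x (c x u), ?_, Dynamics.mem_dynEntourage.2 (hc x u _ hu h1 h2.symm)⟩
    exact Finset.mem_coe.2 (Finset.mem_biUnion.2
      ⟨x, hx, Finset.mem_image_of_mem _ (Finset.mem_univ _)⟩)
  have hcard : (T.card : ℝ) ≤ B * s.card := by
    have h1 : T.card ≤ ∑ x ∈ s, m x := Finset.card_biUnion_le.trans
      (Finset.sum_le_sum fun x _ => Finset.card_image_le.trans (by simp))
    calc (T.card : ℝ) ≤ ∑ x ∈ s, (m x : ℝ) := by exact_mod_cast h1
      _ ≤ ∑ x ∈ s, B := Finset.sum_le_sum fun x _ => hm x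
      _ = B * s.card := by rw [Finset.sum_const, nsmul_eq_mul, mul_comm]
  have h1 : (Dynamics.coverMincard ψ Set.univ {p | dist p.1 p.2 < ε} n : ENNReal) ≤
      (T.card : ENNReal) := by
    exact_mod_cast ENat.toENNReal_mono hT.coverMincard_le_card
  refine h1.trans ?_
  rw [← ENNReal.ofReal_natCast, ← ENNReal.ofReal_natCast, ← ENNReal.ofReal_mul' (Nat.cast_nonneg _)]
  exact ENNReal.ofReal_le_ofReal hcard

/-- A finite-to-one factor map of compact systems preserves the topological entropy. -/
theorem entropy_eq_of_finiteToOne [CompactSpace X] [CompactSpace Y] {ψ : Y ≃ₜ Y} {φ : X ≃ₜ X}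
    {π : Y → X} (h : IsFactorMap ψ φ π) (hfin : FiniteToOne π) : entropy ψ = entropy φ := by
  refine le_antisymm ?_ ?_
  · have key : ∀ a : ℝ, 0 < a → entropy ψ ≤ entropy φ + a := by
      intro a ha
      rw [entropy, Dynamics.coverEntropy_eq_iSup_basis Metric.uniformity_basis_dist]
      refine iSup₂_le fun ε hε => ?_
      -- The factor `exp (a N)` does not depend on `n` and drops out of the growth rate; `exp (a n)`
      -- contributes exactly `a`.
      obtain ⟨N, δ, hδ, hcol⟩ := exists_colouring h.continuous h.semiconj hfin ha hε
      have hb : ∀ n : ℕ, (Dynamics.coverMincard ψ Set.univ {p | dist p.1 p.2 < ε} n : ENNReal) ≤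
          ENNReal.ofReal (Real.exp (a * N)) * (((fun n : ℕ => EReal.exp ((a : EReal) * n)) *
            fun n : ℕ =>
              (Dynamics.coverMincard φ Set.univ {p | dist p.1 p.2 < δ} n : ENNReal)) n) := by
        intro n
        have hfi := Dynamics.coverMincard_finite_of_isCompact_uniformContinuous
          (T := φ) (isCompact_univ (X := X))
          (CompactSpace.uniformContinuous_of_continuous φ.continuous)
          (Metric.dist_mem_uniformity hδ) n
        obtain ⟨s, hs, hsc⟩ := (Dynamics.coverMincard_finite_iff _ _ _ _).1 hfi
        have h1 := coverMincard_le_of_colouring (hcol n) hs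
        have h2 : EReal.exp ((a : EReal) * n) = ENNReal.ofReal (Real.exp (a * n)) := by
          rw [← EReal.exp_coe]
          congr 1
        rw [Pi.mul_apply, ← hsc, h2, ← mul_assoc, ← ENNReal.ofReal_mul (Real.exp_pos _).le,
          ← Real.exp_add, ← mul_add, add_comm (N : ℝ)]
        simpa using h1
      refine (ExpGrowth.expGrowthSup_le_of_eventually_le ENNReal.ofReal_ne_top
        (Eventually.of_forall hb)).trans ?_
      refine (ExpGrowth.expGrowthSup_mul_le ?_ ?_).trans ?_
      · rw [ExpGrowth.expGrowthSup_exp]; exact Or.inl (EReal.coe_ne_bot a)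
      · rw [ExpGrowth.expGrowthSup_exp]; exact Or.inl (EReal.coe_ne_top a)
      · rw [ExpGrowth.expGrowthSup_exp, add_comm]
        exact add_le_add_left (Dynamics.coverEntropyEntourage_le_coverEntropy _ _
          (Metric.dist_mem_uniformity hδ)) _
    refine EReal.le_of_forall_lt_iff_le.1 fun z hz => ?_
    generalize entropy φ = e at key hz
    induction e with
    | bot => exact (key 1 one_pos).trans (by simp)
    | top => exact absurd hz (not_lt.2 le_top)
    | coe e =>
      refine (key (z - e) (sub_pos.2 (EReal.coe_lt_coe_iff.1 hz))).trans (le_of_eq ?_)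
      rw [← EReal.coe_add]
      congr 1
      ring
  · have := Dynamics.coverEntropy_image_le_of_uniformContinuous h.semiconj
      (CompactSpace.uniformContinuous_of_continuous h.continuous) Set.univ
    rwa [Set.image_univ, h.surjective.range_eq] at this

theorem FinitelyEquivalent.entropy_eq [CompactSpace X] [CompactSpace Y] {φ : X ≃ₜ X} {ψ : Y ≃ₜ Y}
    (h : FinitelyEquivalent.{u, v, w} φ ψ) : entropy φ = entropy ψ := by
  obtain ⟨M, _, μ, πX, πY, hμ, ⟨hX, hXf⟩, hY, hYf⟩ := h
  have := hμ.compact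
  rw [← entropy_eq_of_finiteToOne hX hXf, entropy_eq_of_finiteToOne hY hYf]

end Bowen

namespace Graph

/-! ### Entropy of edge shifts -/

variable {V : Type u} {E : Type v} {G : Graph V E}

theorem NoSourcesOrSinks.exists_forward (hG : G.NoSourcesOrSinks) :
    ∃ f : E → E, ∀ e, G.t e = G.i (f e) := by
  choose f hf using hG.2
  exact ⟨fun e => f (G.t e), fun e => (hf _).symm⟩

theorem NoSourcesOrSinks.exists_backward (hG : G.NoSourcesOrSinks) :
    ∃ f : E → E, ∀ e, G.t (f e) = G.i e := by
  choose f hf using hG.1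
  exact ⟨fun e => f (G.i e), fun e => hf _⟩

/-- Every edge occurs in a bi-infinite path. -/
theorem NoSourcesOrSinks.exists_shift (hG : G.NoSourcesOrSinks) (e : E) :
    ∃ x : G.Shift, x.edge 0 = e := by
  obtain ⟨f, hf⟩ := hG.exists_forward
  obtain ⟨b, hb⟩ := hG.exists_backward
  refine ⟨⟨fun k => if 0 ≤ k then f^[k.toNat] e else b^[(-k).toNat] e, fun k => ?_⟩, by simp⟩
  rcases lt_trichotomy k (-1) with hk | rfl | hk
  · rw [if_neg (by omega), if_neg (by omega), show (-k).toNat = (-(k + 1)).toNat + 1 by omega,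
      Function.iterate_succ_apply', hb]
  · simp [hb]
  · rw [if_pos (by omega), if_pos (by omega), show (k + 1).toNat = k.toNat + 1 by omega,
      Function.iterate_succ_apply', hf]

/-- The initial part of a bi-infinite path can be continued along any admissible edge. -/
theorem NoSourcesOrSinks.exists_extend (hG : G.NoSourcesOrSinks) (x : G.Shift) (n : ℤ) (e : E)
    (he : G.t (x.edge n) = G.i e) :
    ∃ y : G.Shift, (∀ k ≤ n, y.edge k = x.edge k) ∧ y.edge (n + 1) = e := by
  obtain ⟨z, hz⟩ := hG.exists_shift e
  refine ⟨⟨fun k => if k ≤ n then x.edge k else z.edge (k - (n + 1)), fun k => ?_⟩,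
    fun k hk => if_pos hk, ?_⟩
  · rcases lt_trichotomy k n with hk | rfl | hk
    · rw [if_pos (by omega), if_pos (by omega)]
      exact x.valid k
    · rw [if_pos le_rfl, if_neg (by omega), sub_self, hz, he]
    · rw [if_neg (by omega), if_neg (by omega), z.valid]
      congr 2
      ring
  · simp [hz]

/-- The word `x₀ … xₙ` of a path. -/
def window (n : ℕ) (x : G.Shift) : Fin (n + 1) → E := fun k => x.edge k

open Classical in
/-- The set of words of length `n + 1` of the edge shift. -/
noncomputable def words (G : Graph V E) [Fintype E] (n : ℕ) : Finset (Fin (n + 1) → E) :=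
  Finset.univ.filter fun w => w ∈ Set.range (window (G := G) n)

theorem mem_words [Fintype E] {n : ℕ} {w : Fin (n + 1) → E} :
    w ∈ G.words n ↔ ∃ x, window (G := G) n x = w := by
  simp [words]

theorem window_eq_iff {n : ℕ} {x y : G.Shift} :
    window n x = window n y ↔ ∀ k : ℤ, 0 ≤ k → k ≤ n → x.edge k = y.edge k := by
  refine ⟨fun h k h0 h1 => ?_, fun h => funext fun k => h k (by omega) (by omega)⟩
  have := congrFun h ⟨k.toNat, by omega⟩
  simpa [window, h0] using this

open Classical in
-- Removing the last edge is a bijection onto pairs of a word and an edge leaving its end; every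
-- such pair occurs, since paths can be continued along any admissible edge.
theorem sum_words_succ [Fintype E] (hG : G.NoSourcesOrSinks) (n : ℕ) (f : E → ℝ) :
    ∑ w ∈ G.words (n + 1), f (w (Fin.last _)) =
      ∑ w ∈ G.words n, ∑ e with G.i e = G.t (w (Fin.last _)), f e := by
  rw [Finset.sum_sigma']
  refine Finset.sum_bij' (fun w _ => ⟨Fin.init w, w (Fin.last _)⟩)
    (fun p _ => Fin.snoc (α := fun _ => E) p.1 p.2) ?_ ?_ ?_ ?_ ?_
  · intro w hw
    obtain ⟨x, rfl⟩ := mem_words.1 hw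
    simp only [Finset.mem_sigma, Finset.mem_filter, Finset.mem_univ, true_and]
    refine ⟨mem_words.2 ⟨x, rfl⟩, ?_⟩
    have := x.valid n
    simpa [window, Fin.init] using this.symm
  · rintro ⟨w, e⟩ h
    simp only [Finset.mem_sigma, Finset.mem_filter, Finset.mem_univ, true_and] at h
    obtain ⟨hw, he⟩ := h
    obtain ⟨x, rfl⟩ := mem_words.1 hw
    obtain ⟨y, hy, hye⟩ := hG.exists_extend x n e (by simpa [window] using he.symm)
    refine mem_words.2 ⟨y, funext fun k => ?_⟩
    refine Fin.lastCases ?_ (fun k => ?_) k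
    · simpa [window] using hye
    · simpa [window] using hy k (by omega)
  · intro w _
    simp
  · rintro ⟨w, e⟩ _
    simp
  · intro w _
    rfl

/-- The adjacency matrix with real entries. -/
noncomputable def realAdj (G : Graph V E) : Matrix V V ℝ := G.adj.map Nat.cast

open Classical in
theorem sum_edges_eq_mulVec [Fintype V] [Fintype E] (r : V → ℝ) (v : V) :
    ∑ e with G.i e = v, r (G.t e) = G.realAdj.mulVec r v := by
  rw [Matrix.mulVec, dotProduct, ← Finset.sum_fiberwise _ G.t]
  refine Finset.sum_congr rfl fun w _ => ?_
  rw [Finset.sum_congr rfl (g := fun _ => r w) fun e he => by rw [(Finset.mem_filter.1 he).2],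
    Finset.sum_const, nsmul_eq_mul, Finset.filter_filter]
  simp [realAdj, adj, Nat.card_eq_fintype_card, Fintype.card_subtype]

/-- Weighting a word by the eigenvector at its terminal vertex makes each extension multiply the
total by exactly `l`. -/
theorem sum_words [Fintype V] [Fintype E] (hG : G.NoSourcesOrSinks) {l : ℝ} {r : V → ℝ}
    (hr : G.realAdj.mulVec r = l • r) (n : ℕ) :
    ∑ w ∈ G.words n, r (G.t (w (Fin.last _))) =
      l ^ n * ∑ w ∈ G.words 0, r (G.t (w (Fin.last _))) := by
  classical
  induction n with
  | zero => simp
  | succ n ih =>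
    rw [sum_words_succ hG n fun e => r (G.t e), pow_succ, mul_comm (l ^ n), mul_assoc, ← ih,
      Finset.mul_sum]
    refine Finset.sum_congr rfl fun w _ => ?_
    rw [sum_edges_eq_mulVec r, hr]
    rfl

/-- The number of words grows like the powers of an eigenvalue with a positive eigenvector. -/
theorem card_words_bounds [Fintype V] [Fintype E] [Nonempty G.Shift] (hG : G.NoSourcesOrSinks)
    {l : ℝ} {r : V → ℝ} (hr0 : ∀ v, 0 < r v) (hr : G.realAdj.mulVec r = l • r) :
    0 < l ∧ ∃ c C : ℝ, 0 < c ∧ 0 < C ∧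
      ∀ n, c * l ^ n ≤ (G.words n).card ∧ ((G.words n).card : ℝ) ≤ C * l ^ n := by
  obtain ⟨x⟩ := ‹Nonempty G.Shift›
  have : Nonempty V := ⟨G.t (x.edge 0)⟩
  obtain ⟨a, -, ha⟩ := Finset.exists_min_image Finset.univ r Finset.univ_nonempty
  obtain ⟨b, -, hb⟩ := Finset.exists_max_image Finset.univ r Finset.univ_nonempty
  have hpos : ∀ n, 0 < ∑ w ∈ G.words n, r (G.t (w (Fin.last _))) := fun n =>
    Finset.sum_pos (fun w _ => hr0 _) ⟨_, mem_words.2 ⟨x, rfl⟩⟩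
  set S := ∑ w ∈ G.words 0, r (G.t (w (Fin.last _))) with hS
  have hS0 : 0 < S := hpos 0
  have hl : 0 < l := by
    have h1 := hpos 1
    rw [sum_words hG hr, pow_one, ← hS] at h1
    exact pos_of_mul_pos_left h1 hS0.le
  -- Each weight lies between the minimum `r a` and the maximum `r b`.
  refine ⟨hl, S / r b, S / r a, div_pos hS0 (hr0 b), div_pos hS0 (hr0 a), fun n => ⟨?_, ?_⟩⟩
  · have h1 : l ^ n * S ≤ (G.words n).card * r b := by
      rw [hS, ← sum_words hG hr, ← nsmul_eq_mul]
      exact Finset.sum_le_card_nsmul _ _ _ fun w _ => hb _ (Finset.mem_univ _)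
    rw [div_mul_eq_mul_div, div_le_iff₀ (hr0 b)]
    linarith
  · have h1 : (G.words n).card * r a ≤ l ^ n * S := by
      rw [hS, ← sum_words hG hr, ← nsmul_eq_mul]
      exact Finset.card_nsmul_le_sum _ _ _ fun w _ => ha _ (Finset.mem_univ _)
    rw [div_mul_eq_mul_div, le_div_iff₀ (hr0 a)]
    linarith

/-- Paths agreeing at the places `-K, …, K + n` stay close for times below `n`, so one path per word
of length `2 * K + n + 1` suffices. The shift by `K` moves this range to the window starting at `0`.
-/
theorem coverMincard_shift_le [Fintype E] (K n : ℕ) :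
    Dynamics.coverMincard G.shift Set.univ {p | dist p.1 p.2 ≤ (1 / 2 : ℝ) ^ (K + 1)} n ≤
      (G.words (2 * K + n)).card := by
  classical
  have hch : ∀ w : Fin (2 * K + n + 1) → E, w ∈ G.words (2 * K + n) →
      ∃ x : G.Shift, window (2 * K + n) x = w := fun w hw => mem_words.1 hw
  choose x hx using hch
  let s : Finset G.Shift :=
    (G.words (2 * K + n)).attach.image fun w => G.shift^[K] (x w.1 w.2)
  have hs : Dynamics.IsDynCoverOf G.shift Set.univ
      {p | dist p.1 p.2 ≤ (1 / 2 : ℝ) ^ (K + 1)} n (s : Set G.Shift) := by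
    intro y _
    have hw : window (2 * K + n) (G.shift.symm^[K] y) ∈ G.words (2 * K + n) :=
      mem_words.2 ⟨_, rfl⟩
    refine ⟨G.shift^[K] (x _ hw), ?_, ?_⟩
    · exact Finset.mem_coe.2 (Finset.mem_image.2 ⟨⟨_, hw⟩, Finset.mem_attach _ _, rfl⟩)
    · have h1 := window_eq_iff.1 (hx _ hw)
      have h2 : ∀ k : ℤ, -K ≤ k → k ≤ K + n → y.edge k = (G.shift^[K] (x _ hw)).edge k := by
        intro k hk hk'
        rw [shift_iterate_edge, h1 (k + K) (by omega) (by push_cast; omega),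
          shift_symm_iterate_edge, add_sub_cancel_right]
      refine Dynamics.mem_dynEntourage.2 fun j hj => dist_le_pow_iff.2 ⟨?_, fun k hk hk' => ?_⟩
      · rw [shift_iterate_edge, shift_iterate_edge, h2 _ (by omega) (by omega)]
      · rw [shift_iterate_edge, shift_iterate_edge, h2 _ (by omega) (by omega)]
  refine hs.coverMincard_le_card.trans ?_
  exact_mod_cast Finset.card_image_le.trans (by simp)

/-- Staying within `1 / 4` for `n + 1` steps fixes the edges at places `1, …, n + 1`. Paths with
different words there, obtained by shifting back once, have disjoint dynamical balls. -/
theorem card_words_le_netMaxcard [Fintype E] (n : ℕ) :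
    ((G.words n).card : ℕ∞) ≤
      Dynamics.netMaxcard G.shift Set.univ {p | dist p.1 p.2 ≤ (1 / 2 : ℝ) ^ (1 + 1)} (n + 1) := by
  classical
  have hch : ∀ w : Fin (n + 1) → E, w ∈ G.words n → ∃ x : G.Shift, window n x = w :=
    fun w hw => mem_words.1 hw
  choose x hx using hch
  let y : {w // w ∈ G.words n} → G.Shift := fun w => G.shift.symm (x w.1 w.2)
  have hy : ∀ w w' z, (y w, z) ∈ Dynamics.dynEntourage G.shift
      {p | dist p.1 p.2 ≤ (1 / 2 : ℝ) ^ (1 + 1)} (n + 1) → (y w', z) ∈ Dynamics.dynEntourage G.shift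
      {p | dist p.1 p.2 ≤ (1 / 2 : ℝ) ^ (1 + 1)} (n + 1) → w = w' := by
    intro w w' z h h'
    have key : ∀ w, (y w, z) ∈ Dynamics.dynEntourage G.shift
        {p | dist p.1 p.2 ≤ (1 / 2 : ℝ) ^ (1 + 1)} (n + 1) →
        ∀ k : ℤ, 0 ≤ k → k ≤ n → (x w.1 w.2).edge k = z.edge (k + 1) := by
      intro w h k hk hk'
      have h1 := (dist_le_pow_iff.1 (Dynamics.mem_dynEntourage.1 h k.toNat (by omega))).2 1
        (by norm_num) (by norm_num)
      rw [shift_iterate_edge, shift_iterate_edge, shift_symm_apply, Int.toNat_of_nonneg hk] at h1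
      rw [← add_comm (1 : ℤ), ← h1]
      congr 1
      ring
    refine Subtype.ext ?_
    rw [← hx w.1 w.2, ← hx w'.1 w'.2, window_eq_iff]
    exact fun k hk hk' => (key w h k hk hk').trans (key w' h' k hk hk').symm
  have hrefl : ∀ w, (y w, y w) ∈ Dynamics.dynEntourage G.shift
      {p | dist p.1 p.2 ≤ (1 / 2 : ℝ) ^ (1 + 1)} (n + 1) := fun w =>
    Dynamics.mem_dynEntourage.2 fun k _ => by simp
  have hinj : Function.Injective y := fun w w' h => hy w w' (y w') (h ▸ hrefl _) (hrefl _)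
  have hnet : Dynamics.IsDynNetIn G.shift Set.univ
      {p | dist p.1 p.2 ≤ (1 / 2 : ℝ) ^ (1 + 1)} (n + 1)
      ((Finset.univ.image y : Finset G.Shift) : Set G.Shift) := by
    refine ⟨Set.subset_univ _, fun p hp q hq hpq => ?_⟩
    simp only [Finset.coe_image, Finset.coe_univ, Set.image_univ, Set.mem_range] at hp hq
    obtain ⟨w, rfl⟩ := hp
    obtain ⟨w', rfl⟩ := hq
    exact Set.disjoint_left.2 fun z hz hz' => hpq (congrArg y (hy w w' z hz hz'))
  have h := hnet.card_le_netMaxcard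
  rwa [Finset.card_image_of_injective _ hinj, Finset.card_univ, Fintype.card_coe] at h

/-- The entropy of an edge shift is the logarithm of an eigenvalue of the adjacency matrix with a
positive eigenvector. -/
theorem entropy_shift [Fintype V] [Fintype E] [Nonempty G.Shift] (hG : G.NoSourcesOrSinks)
    {l : ℝ} {r : V → ℝ} (hr0 : ∀ v, 0 < r v) (hr : G.realAdj.mulVec r = l • r) :
    0 < l ∧ entropy G.shift = Real.log l := by
  obtain ⟨hl, c, C, hc, hC, hb⟩ := card_words_bounds hG hr0 hr
  refine ⟨hl, ?_⟩
  rw [← ENNReal.log_ofReal_of_pos hl, ← ExpGrowth.expGrowthSup_pow (b := ENNReal.ofReal l)]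
  refine le_antisymm ?_ ?_
  · have hbasis := Metric.uniformity_basis_dist_le_pow (α := G.Shift) (r := 1 / 2) (by norm_num)
      (by norm_num)
    rw [entropy, Dynamics.coverEntropy_eq_iSup_basis hbasis]
    refine iSup₂_le fun K _ => ?_
    refine (Dynamics.coverEntropyEntourage_antitone _ _
      (a := {p : G.Shift × G.Shift | dist p.1 p.2 ≤ (1 / 2 : ℝ) ^ (K + 1)}) ?_).trans ?_
    · exact fun p (hp : dist p.1 p.2 ≤ _) => hp.trans
        (pow_le_pow_of_le_one (by norm_num) (by norm_num) (Nat.le_succ K))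
    refine ExpGrowth.expGrowthSup_le_of_eventually_le (b := ENNReal.ofReal (C * l ^ (2 * K)))
      ENNReal.ofReal_ne_top (Eventually.of_forall fun n => ?_)
    refine (ENat.toENNReal_mono (coverMincard_shift_le K n)).trans ?_
    rw [← ENNReal.ofReal_pow hl.le, ← ENNReal.ofReal_mul (by positivity), mul_assoc, ← pow_add]
    simpa using ENNReal.ofReal_le_ofReal (hb (2 * K + n)).2
  · refine le_trans ?_ (Dynamics.netEntropyEntourage_le_coverEntropy
      (U := {p : G.Shift × G.Shift | dist p.1 p.2 ≤ (1 / 2 : ℝ) ^ (1 + 1)}) _ _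
      (Metric.uniformity_basis_dist_le.mem_of_mem (by positivity)))
    -- Division by `l` absorbs the off-by-one: time `n + 1` is compared with `c * l ^ n`.
    refine ExpGrowth.expGrowthSup_of_eventually_ge (b := ENNReal.ofReal (c / l))
      (by simpa using div_pos hc hl) (eventually_atTop.2 ⟨1, fun n hn => ?_⟩)
    obtain ⟨n, rfl⟩ := Nat.exists_eq_add_of_le' hn
    refine le_trans ?_ (ENat.toENNReal_mono (card_words_le_netMaxcard n))
    rw [← ENNReal.ofReal_pow hl.le, ← ENNReal.ofReal_mul (by positivity), pow_succ',
      ← mul_assoc, div_mul_cancel₀ _ hl.ne']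
    simpa using ENNReal.ofReal_le_ofReal (hb n).1

end Graph

/-! ### Equal entropy gives an intertwining matrix -/

section Rational

variable {m n : Type*} [Fintype m] [Fintype n]

theorem exists_nat_multiple {ι : Type*} [Fintype ι] (q : ι → ℚ) (hq : ∀ i, 0 ≤ q i) :
    ∃ (D : ℕ) (a : ι → ℕ), 0 < D ∧ ∀ i, (a i : ℚ) = D * q i := by
  classical
  refine ⟨∏ i, (q i).den, fun i => (∏ j ∈ Finset.univ.erase i, (q j).den) * (q i).num.toNat,
    Finset.prod_pos fun i _ => (q i).den_pos, fun i => ?_⟩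
  have h1 : ((q i).num.toNat : ℚ) = (q i).den * q i := by
    rw [mul_comm, Rat.mul_den_eq_num]
    exact_mod_cast Int.toNat_of_nonneg (Rat.num_nonneg.2 (hq i))
  rw [← Finset.prod_erase_mul _ _ (Finset.mem_univ i)]
  push_cast
  rw [h1]
  ring

/-- A positive real solution of a linear matrix equation with integral coefficients yields a
nonzero solution in natural numbers. -/
theorem exists_nat_intertwiner [Nonempty m] [Nonempty n] (A : Matrix n n ℕ) (B : Matrix m m ℕ)
    (F : Matrix m n ℝ) (hF : ∀ i j, 0 < F i j)
    (h : F * A.map (Nat.cast : ℕ → ℝ) = B.map (Nat.cast : ℕ → ℝ) * F) :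
    ∃ F' : Matrix m n ℕ, F' ≠ 0 ∧ F' * A = B * F' := by
  classical
  -- In rational coordinates with respect to a basis `b` of this span, the equations hold
  -- coordinatewise. They therefore survive replacing the real numbers `b k` by any rationals, and
  -- positivity survives if these are close enough.
  let S : Submodule ℚ ℝ := Submodule.span ℚ (Set.range fun p : m × n => F p.1 p.2)
  have hfd : FiniteDimensional ℚ S := FiniteDimensional.span_of_finite ℚ (Set.finite_range _)
  let b := Module.finBasis ℚ S
  let f : m → n → S := fun i j => ⟨F i j, Submodule.subset_span ⟨(i, j), rfl⟩⟩
  have hrel : ∀ i j, ∑ k, A k j • f i k = ∑ k, B i k • f k j := by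
    intro i j
    have := congrFun (congrFun h i) j
    simp only [Matrix.mul_apply, Matrix.map_apply] at this
    refine Subtype.ext ?_
    simp only [AddSubmonoidClass.coe_finsetSum, Submodule.coe_smul_of_tower, nsmul_eq_mul, f]
    rw [← this]
    exact Finset.sum_congr rfl fun k _ => mul_comm _ _
  have hco : ∀ i j, F i j = ∑ k, (b.repr (f i j) k : ℝ) * (b k : ℝ) := by
    intro i j
    have := congrArg (Subtype.val) (b.sum_repr (f i j))
    rw [AddSubmonoidClass.coe_finsetSum] at this
    change _ = F i j at this
    rw [← this]
    exact Finset.sum_congr rfl fun k _ => by rw [Submodule.coe_smul, Rat.smul_def]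
  have hopen : IsOpen {c : Fin (Module.finrank ℚ S) → ℝ |
      ∀ i j, 0 < ∑ k, (b.repr (f i j) k : ℝ) * c k} := by
    simp only [Set.ofPred_forall]
    exact isOpen_iInter_of_finite fun i => isOpen_iInter_of_finite fun j =>
      isOpen_lt continuous_const (by fun_prop)
  obtain ⟨c, hc⟩ := (DenseRange.piMap fun _ : Fin (Module.finrank ℚ S) =>
    Rat.denseRange_cast (𝕜 := ℝ)).exists_mem_open hopen
    ⟨fun k => (b k : ℝ), fun i j => by rw [← hco]; exact hF i j⟩
  let R : m → n → ℚ := fun i j => ∑ k, b.repr (f i j) k * c k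
  have hR : ∀ i j, 0 < R i j := fun i j => by
    have := hc i j
    simp only [Pi.map_apply] at this
    exact_mod_cast this
  have hRrel : ∀ i j, ∑ k, R i k * A k j = ∑ k, B i k * R k j := by
    intro i j
    -- The functional sending `b k` to `c k` maps the real relations to rational ones.
    let T : S →ₗ[ℚ] ℚ := ∑ k, c k • b.coord k
    have hT : ∀ i j, R i j = T (f i j) := fun i j => by
      simp [T, R, mul_comm]
    have := congrArg T (hrel i j)
    simp only [map_sum, map_nsmul, nsmul_eq_mul, ← hT] at this
    rw [← this]
    exact Finset.sum_congr rfl fun k _ => mul_comm _ _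
  obtain ⟨D, a, hD, ha⟩ := exists_nat_multiple (fun p : m × n => R p.1 p.2) fun p => (hR _ _).le
  refine ⟨Matrix.of fun i j => a (i, j), ?_, ?_⟩
  · obtain ⟨i⟩ := ‹Nonempty m›
    obtain ⟨j⟩ := ‹Nonempty n›
    intro h0
    have h1 : a (i, j) = 0 := congrFun (congrFun h0 i) j
    have h2 := ha (i, j)
    rw [h1] at h2
    have h3 : (0 : ℚ) < D * R i j := mul_pos (by exact_mod_cast hD) (hR i j)
    simp only [Nat.cast_zero] at h2
    linarith
  · ext i j
    simp only [Matrix.mul_apply, Matrix.of_apply]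
    have h1 := congrArg (fun t => (D : ℚ) * t) (hRrel i j)
    simp only [Finset.mul_sum] at h1
    have : ((∑ k, a (i, k) * A k j : ℕ) : ℚ) = ((∑ k, B i k * a (k, j) : ℕ) : ℚ) := by
      push_cast
      simp only [ha]
      convert h1 using 2
      · ring
      · ring
    exact_mod_cast this

end Rational

/-! ### Perron eigenvectors of irreducible graphs -/

namespace Graph

variable {V : Type u} {E : Type v} {G : Graph V E}

theorem adj_pos_iff [Finite E] {a b : V} : 0 < G.adj a b ↔ ∃ e, G.i e = a ∧ G.t e = b := by
  rw [adj, Matrix.of_apply, Nat.card_pos_iff]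
  simp [Subtype.finite]

theorem IsIrreducible.exists_pow_pos [Fintype V] [DecidableEq V] [Finite E]
    (hG : G.IsIrreducible) (a b : V) : ∃ k, 0 < (G.realAdj ^ k) a b := by
  have h0 : ∀ i j, 0 ≤ G.realAdj i j := fun i j => by simp [realAdj]
  induction hG.2 a b with
  | refl => exact ⟨0, by simp⟩
  | tail _ he ih =>
    rename_i c d _
    obtain ⟨k, hk⟩ := ih
    refine ⟨k + 1, ?_⟩
    rw [pow_succ, Matrix.mul_apply]
    refine Finset.sum_pos' (fun j _ => mul_nonneg (Matrix.pow_apply_nonneg h0 k a j) (h0 j d))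
      ⟨c, Finset.mem_univ c, mul_pos hk ?_⟩
    simpa [realAdj] using adj_pos_iff.2 he

theorem NoSourcesOrSinks.nonempty_shift [Nonempty V] (hG : G.NoSourcesOrSinks) :
    Nonempty G.Shift := by
  obtain ⟨v⟩ := ‹Nonempty V›
  obtain ⟨e, -⟩ := hG.1 v
  obtain ⟨x, -⟩ := hG.exists_shift e
  exact ⟨x⟩

theorem IsIrreducible.exists_right_eigenvector [Fintype V] [Fintype E] (hG : G.NoSourcesOrSinks)
    (hirr : G.IsIrreducible) : ∃ (l : ℝ) (r : V → ℝ), (∀ v, 0 < r v) ∧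
      G.realAdj.mulVec r = l • r ∧ 0 < l ∧ entropy G.shift = Real.log l := by
  classical
  have := hirr.1
  have := hG.nonempty_shift
  obtain ⟨l, r, h0, h⟩ := exists_pos_eigenvector (A := G.realAdj) (fun i j => by simp [realAdj])
    hirr.exists_pow_pos
  exact ⟨l, r, h0, h, entropy_shift hG h0 h⟩

/-- Evaluating `s A r` in two ways gives `l' (s ⬝ᵥ r) = l (s ⬝ᵥ r)`, and the pairing of positive
vectors is nonzero. So left and right eigenvalues agree. -/
theorem IsIrreducible.exists_left_eigenvector [Fintype V] [Finite E] (hirr : G.IsIrreducible)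
    {l : ℝ} {r : V → ℝ} (hr0 : ∀ v, 0 < r v) (hr : G.realAdj.mulVec r = l • r) :
    ∃ s : V → ℝ, (∀ v, 0 < s v) ∧ Matrix.vecMul s G.realAdj = l • s := by
  classical
  have := hirr.1
  obtain ⟨l', s, h0, h⟩ := exists_pos_eigenvector (A := G.realAdj.transpose)
    (fun i j => by simp [realAdj]) fun i j => by
      obtain ⟨k, hk⟩ := hirr.exists_pow_pos j i
      exact ⟨k, by rwa [← Matrix.transpose_pow]⟩
  rw [Matrix.mulVec_transpose] at h
  have h1 := Matrix.dotProduct_mulVec s G.realAdj r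
  rw [h, hr, dotProduct_smul, smul_dotProduct, smul_eq_mul, smul_eq_mul] at h1
  have h2 : 0 < s ⬝ᵥ r := Finset.sum_pos (fun v _ => mul_pos (h0 v) (hr0 v)) Finset.univ_nonempty
  exact ⟨s, h0, by rw [h, mul_right_cancel₀ h2.ne' h1]⟩

theorem exists_intertwiner_of_entropy_eq {V' : Type*} {E' : Type*} [Fintype V] [Fintype E]
    [Fintype V'] [Fintype E'] {H : Graph V' E'} (hG : G.NoSourcesOrSinks)
    (hH : H.NoSourcesOrSinks) (hGirr : G.IsIrreducible) (hHirr : H.IsIrreducible)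
    (h : entropy G.shift = entropy H.shift) :
    ∃ F : Matrix V' V ℕ, F ≠ 0 ∧ F * G.adj = H.adj * F := by
  have := hGirr.1
  have := hHirr.1
  obtain ⟨l, r, hr0, hr, hl, hGe⟩ := hGirr.exists_right_eigenvector hG
  obtain ⟨l', r', hr0', hr', hl', hHe⟩ := hHirr.exists_right_eigenvector hH
  rw [hGe, hHe, EReal.coe_eq_coe_iff] at h
  obtain rfl := Real.log_injOn_pos hl hl' h
  obtain ⟨s, hs0, hs⟩ := hGirr.exists_left_eigenvector hr0 hr
  refine exists_nat_intertwiner _ _ (Matrix.vecMulVec r' s) (fun i j => mul_pos (hr0' i) (hs0 j)) ?_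
  change Matrix.vecMulVec r' s * G.realAdj = H.realAdj * Matrix.vecMulVec r' s
  rw [Matrix.vecMulVec_mul, Matrix.mul_vecMulVec, hs, hr', Matrix.vecMulVec_smul,
    Matrix.smul_vecMulVec]

end Graph

namespace Graph

/-! ### Coverings of graphs -/

section Covering

variable {V : Type u} {E : Type v} {G : Graph V E} {V' : Type u₁} {E' : Type v₁} {M : Graph V' E'}

theorem mem_stableSet_shift {x y : G.Shift} :
    y ∈ stableSet G.shift x ↔ ∃ n : ℤ, ∀ k, n ≤ k → x.edge k = y.edge k := by
  constructor
  · intro h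
    obtain ⟨N, hN⟩ := eventually_atTop.1
      (Tendsto.eventually_le_const (by norm_num : (0 : ℝ) < 1 / 4) h)
    refine ⟨N + 1, fun k hk => ?_⟩
    have := (dist_quarter (hN (k - 1).toNat (by omega))).2
    rw [shift_iterate_edge, shift_iterate_edge] at this
    rwa [show (1 : ℤ) + ((k - 1).toNat : ℤ) = k by omega] at this
  · rintro ⟨n, hn⟩
    refine Metric.tendsto_atTop.2 fun ε hε => ?_
    obtain ⟨K, hK⟩ := exists_pow_lt_of_lt_one hε (by norm_num : (1 / 2 : ℝ) < 1)
    refine ⟨(n + K).toNat, fun j hj => ?_⟩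
    have hA : Agree (G.shift^[j] x) (G.shift^[j] y) K := by
      refine ⟨?_, fun k hk hk' => ?_⟩
      · rw [shift_iterate_edge, shift_iterate_edge, hn _ (by omega)]
      · rw [shift_iterate_edge, shift_iterate_edge, hn _ (by omega)]
    rw [Real.dist_0_eq_abs, abs_of_nonneg dist_nonneg]
    exact (hA.dist_le.trans
      (pow_le_pow_of_le_one (by norm_num) (by norm_num) (Nat.le_succ K))).trans_lt hK

theorem mem_unstableSet_shift {x y : G.Shift} :
    y ∈ unstableSet G.shift x ↔ ∃ n : ℤ, ∀ k, k ≤ n → x.edge k = y.edge k := by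
  constructor
  · intro h
    obtain ⟨N, hN⟩ := eventually_atTop.1
      (Tendsto.eventually_le_const (by norm_num : (0 : ℝ) < 1 / 4) h)
    refine ⟨1 - N, fun k hk => ?_⟩
    have := (dist_quarter (hN (1 - k).toNat (by omega))).2
    rw [shift_symm_iterate_edge, shift_symm_iterate_edge] at this
    rwa [show (1 : ℤ) - ((1 - k).toNat : ℤ) = k by omega] at this
  · rintro ⟨n, hn⟩
    refine Metric.tendsto_atTop.2 fun ε hε => ?_
    obtain ⟨K, hK⟩ := exists_pow_lt_of_lt_one hε (by norm_num : (1 / 2 : ℝ) < 1)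
    refine ⟨(K - n).toNat, fun j hj => ?_⟩
    have hA : Agree (G.shift.symm^[j] x) (G.shift.symm^[j] y) K := by
      refine ⟨?_, fun k hk hk' => ?_⟩
      · rw [shift_symm_iterate_edge, shift_symm_iterate_edge, hn _ (by omega)]
      · rw [shift_symm_iterate_edge, shift_symm_iterate_edge, hn _ (by omega)]
    rw [Real.dist_0_eq_abs, abs_of_nonneg dist_nonneg]
    exact (hA.dist_le.trans
      (pow_le_pow_of_le_one (by norm_num) (by norm_num) (Nat.le_succ K))).trans_lt hK

/-- `(p, q)` is a homomorphism of graphs. -/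
structure IsHom (M : Graph V' E') (G : Graph V E) (p : V' → V) (q : E' → E) : Prop where
  i_map : ∀ e, G.i (q e) = p (M.i e)
  t_map : ∀ e, G.t (q e) = p (M.t e)

/-- The map of edge shifts induced by a homomorphism of graphs. -/
def IsHom.map {p : V' → V} {q : E' → E} (h : IsHom M G p q) (x : M.Shift) : G.Shift where
  edge k := q (x.edge k)
  valid k := by rw [h.t_map, h.i_map, x.valid]

variable {p : V' → V} {q : E' → E}

theorem IsHom.map_edge (h : IsHom M G p q) (x : M.Shift) (k : ℤ) :
    (h.map x).edge k = q (x.edge k) := rfl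

theorem IsHom.continuous_map (h : IsHom M G p q) : Continuous h.map := by
  rw [← continuousOn_univ]
  refine continuousOn_of_agree fun z _ K => ⟨(1 / 2) ^ K, by positivity, fun z' _ hd => ?_⟩
  have hA := agree_of_dist_lt hd
  exact ⟨by rw [map_edge, map_edge, h.t_map, h.t_map, hA.1],
    fun k hk hk' => congrArg q (hA.2 k hk hk')⟩

/-- A right covering: edges lift uniquely once the initial vertex is lifted. -/
structure IsRightCovering (M : Graph V' E') (G : Graph V E) (p : V' → V) (q : E' → E) : Prop
    extends IsHom M G p q where
  lift : ∀ a e, G.i e = p a → ∃ e', M.i e' = a ∧ q e' = e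
  inj : ∀ e e', M.i e = M.i e' → q e = q e' → e = e'

/-- The graph with all edges reversed. -/
def op (G : Graph V E) : Graph V E := ⟨G.t, G.i⟩

/-- The reversal of a path. -/
def Shift.rev (x : G.Shift) : G.op.Shift where
  edge k := x.edge (-k)
  valid k := by
    change G.i _ = G.t _
    rw [x.valid]
    congr 2
    ring

theorem NoSourcesOrSinks.op (h : G.NoSourcesOrSinks) : G.op.NoSourcesOrSinks := ⟨h.2, h.1⟩

/-- The past of `x` is kept, and from place `n` on the edges of `y` are lifted one by one, each
starting where the previous lift ends. -/
theorem IsRightCovering.exists_lift (h : IsRightCovering M G p q) (x : M.Shift) (y : G.Shift)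
    (n : ℤ) (hn : q (x.edge n) = y.edge n) :
    ∃ z : M.Shift, (∀ k ≤ n, z.edge k = x.edge k) ∧ ∀ k, n ≤ k → q (z.edge k) = y.edge k := by
  have hL : ∀ a e, ∃ e', G.i e = p a → M.i e' = a ∧ q e' = e := fun a e => by
    by_cases hae : G.i e = p a
    · obtain ⟨e', h'⟩ := h.lift a e hae
      exact ⟨e', fun _ => h'⟩
    -- A default that makes the lifting function total.
    · exact ⟨x.edge 0, fun h' => absurd h' hae⟩
  choose L hL using hL
  let s : ℕ → E' := fun j => Nat.rec (x.edge n) (fun j e => L (M.t e) (y.edge (n + j + 1))) j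
  have hs : ∀ j, s (j + 1) = L (M.t (s j)) (y.edge (n + j + 1)) := fun j => rfl
  have hcomp : ∀ j, q (s j) = y.edge (n + j) → G.i (y.edge (n + j + 1)) = p (M.t (s j)) :=
    fun j hj => by rw [← y.valid, ← hj, h.t_map]
  have hq : ∀ j : ℕ, q (s j) = y.edge (n + j) := by
    intro j
    induction j with
    | zero => simpa [s] using hn
    | succ j ih =>
      rw [hs, (hL _ _ (hcomp j ih)).2]
      congr 1
      push_cast
      ring
  have hi : ∀ j, M.t (s j) = M.i (s (j + 1)) := fun j => by
    rw [hs, (hL _ _ (hcomp j (hq j))).1]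
  refine ⟨⟨fun k => if k ≤ n then x.edge k else s (k - n).toNat, fun k => ?_⟩,
    fun k hk => if_pos hk, fun k hk => ?_⟩
  · rcases lt_trichotomy k n with hk | rfl | hk
    · rw [if_pos (by omega), if_pos (by omega)]
      exact x.valid k
    · rw [if_pos le_rfl, if_neg (by omega)]
      simpa [s] using hi 0
    · rw [if_neg (by omega), if_neg (by omega), hi,
        show (k - n).toNat + 1 = (k + 1 - n).toNat by omega]
  · rcases hk.eq_or_lt with rfl | hk
    · simpa using hn
    · simp only [if_neg (not_le.2 hk), hq]
      congr 1
      omega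

theorem IsRightCovering.eq_of_agree (h : IsRightCovering M G p q) {x y : M.Shift} {n : ℤ}
    (hn : ∀ k ≤ n, x.edge k = y.edge k) (hq : ∀ k, q (x.edge k) = q (y.edge k)) : x = y := by
  refine Shift.ext (funext fun k => ?_)
  rcases le_total k n with hk | hk
  · exact hn k hk
  · induction k, hk using Int.leInduction with
    | base => exact hn n le_rfl
    | succ k _ ih => exact h.inj _ _ (by rw [← x.valid, ← y.valid, ih]) (hq _)

theorem IsRightCovering.exists_partial_lift (h : IsRightCovering M G p q)
    (hM : M.NoSourcesOrSinks) (hp : Function.Surjective p) (y : G.Shift) (n : ℤ) :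
    ∃ x : M.Shift, ∀ k, n ≤ k → q (x.edge k) = y.edge k := by
  obtain ⟨a, ha⟩ := hp (G.i (y.edge n))
  obtain ⟨e, -, he⟩ := h.lift a _ ha.symm
  obtain ⟨x, hx⟩ := hM.exists_shift e
  obtain ⟨z, -, hz⟩ := h.exists_lift
    ⟨fun k => x.edge (k - n), fun k => by
      rw [x.valid, show k - n + 1 = k + 1 - n by ring]⟩ y n (by simp [hx, he])
  exact ⟨z, hz⟩

/-- The image is compact, hence closed; matching arbitrarily long central words makes it dense. -/
theorem IsHom.surjective_map [Finite E'] (h : IsHom M G p q)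
    (hsurj : ∀ (y : G.Shift) (K : ℕ), ∃ x : M.Shift,
      ∀ k : ℤ, -K ≤ k → k ≤ K → q (x.edge k) = y.edge k) : Function.Surjective h.map := by
  intro y
  have hcl : IsClosed (Set.range h.map) := (isCompact_range h.continuous_map).isClosed
  rw [← Set.mem_range, ← hcl.closure_eq, Metric.mem_closure_iff]
  intro ε hε
  obtain ⟨K, hK⟩ := exists_pow_lt_of_lt_one hε (by norm_num : (1 / 2 : ℝ) < 1)
  obtain ⟨x, hx⟩ := hsurj y K
  have hA : Agree y (h.map x) K :=
    ⟨by rw [h.map_edge, hx 0 (by omega) (by omega)],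
      fun k hk hk' => (hx k (by omega) hk').symm⟩
  exact ⟨_, ⟨x, rfl⟩, (hA.dist_le.trans
    (pow_le_pow_of_le_one (by norm_num) (by norm_num) (Nat.le_succ K))).trans_lt hK⟩

theorem IsHom.semiconj_map (h : IsHom M G p q) : Function.Semiconj h.map M.shift G.shift :=
  fun _ => rfl

/-- A right covering induces a u-bijective map of edge shifts. -/
theorem IsRightCovering.isUBijective [Finite E'] (h : IsRightCovering M G p q)
    (hM : M.NoSourcesOrSinks) (hp : Function.Surjective p) :
    IsUBijective M.shift G.shift h.map where
  continuous := h.continuous_map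
  semiconj := h.semiconj_map
  surjective := h.surjective_map fun y K => by
    obtain ⟨x, hx⟩ := h.exists_partial_lift hM hp y (-K)
    exact ⟨x, fun k hk _ => hx k hk⟩
  bijOn x := by
    refine ⟨fun y hy => ?_, fun y hy z hz hyz => ?_, fun y hy => ?_⟩
    · obtain ⟨n, hn⟩ := mem_unstableSet_shift.1 hy
      exact mem_unstableSet_shift.2 ⟨n, fun k hk => congrArg q (hn k hk)⟩
    · obtain ⟨n, hn⟩ := mem_unstableSet_shift.1 hy
      obtain ⟨n', hn'⟩ := mem_unstableSet_shift.1 hz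
      refine h.eq_of_agree (n := min n n') (fun k hk => ?_) fun k => congrArg (·.edge k) hyz
      exact (hn k (by omega)).symm.trans (hn' k (by omega))
    · obtain ⟨n, hn⟩ := mem_unstableSet_shift.1 hy
      obtain ⟨z, hz, hz'⟩ := h.exists_lift x y n (hn n le_rfl)
      refine ⟨z, mem_unstableSet_shift.2 ⟨n, fun k hk => (hz k hk).symm⟩,
        Shift.ext (funext fun k => ?_)⟩
      rcases le_total k n with hk | hk
      · rw [h.map_edge, hz k hk, ← hn k hk, h.map_edge]
      · exact hz' k hk

/-- A left covering, that is a right covering of the reversed graphs, induces an s-bijective map of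
edge shifts. -/
theorem IsRightCovering.isSBijective_of_op [Finite E'] (h : IsHom M G p q)
    (hop : IsRightCovering M.op G.op p q) (hM : M.NoSourcesOrSinks)
    (hp : Function.Surjective p) : IsSBijective M.shift G.shift h.map where
  continuous := h.continuous_map
  semiconj := h.semiconj_map
  surjective := h.surjective_map fun y K => by
    obtain ⟨x, hx⟩ := hop.exists_partial_lift hM.op hp y.rev (-K)
    refine ⟨x.rev, fun k hk hk' => (hx (-k) (by omega)).trans ?_⟩
    simp [Shift.rev]
  bijOn x := by
    refine ⟨fun y hy => ?_, fun y hy z hz hyz => ?_, fun y hy => ?_⟩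
    · obtain ⟨n, hn⟩ := mem_stableSet_shift.1 hy
      exact mem_stableSet_shift.2 ⟨n, fun k hk => congrArg q (hn k hk)⟩
    · obtain ⟨n, hn⟩ := mem_stableSet_shift.1 hy
      obtain ⟨n', hn'⟩ := mem_stableSet_shift.1 hz
      have hrev : y.rev = z.rev := hop.eq_of_agree (n := -max n n')
        (fun k hk => (hn (-k) (by omega)).symm.trans (hn' (-k) (by omega)))
        fun k => congrArg (·.edge (-k)) hyz
      refine Shift.ext (funext fun k => ?_)
      simpa [Shift.rev] using congrArg (·.edge (-k)) hrev
    · obtain ⟨n, hn⟩ := mem_stableSet_shift.1 hy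
      obtain ⟨z, hz, hz'⟩ := hop.exists_lift x.rev y.rev (-n)
        (by simpa [Shift.rev, h.map_edge] using hn n le_rfl)
      refine ⟨z.rev, mem_stableSet_shift.2 ⟨n, fun k hk => ?_⟩, Shift.ext (funext fun k => ?_)⟩
      · simpa [Shift.rev] using (hz (-k) (by omega)).symm
      · change q (z.edge (-k)) = _
        rcases le_total k n with hk | hk
        · simpa [Shift.rev] using hz' (-k) (by omega)
        · rw [hz (-k) (by omega), ← hn k hk]
          simp [Shift.rev, h.map_edge]

end Covering

/-! ### The correspondence defined by an intertwining matrix -/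

section Correspondence

/-- An entry of a matrix product counts composable pairs, sorted by their middle vertex. -/
theorem card_composable {A B I J K : Type*} [Fintype A] [Fintype B] [Fintype J] (a : A → I)
    (b : A → J) (c : B → J) (d : B → K) (i : I) (k : K) :
    Nat.card {p : {p : A × B // b p.1 = c p.2} // (a p.1.1, d p.1.2) = (i, k)} =
      ∑ j, Nat.card {x // a x = i ∧ b x = j} * Nat.card {y // c y = j ∧ d y = k} := by
  classical
  have e : {p : {p : A × B // b p.1 = c p.2} // (a p.1.1, d p.1.2) = (i, k)} ≃
      Σ j, {x // a x = i ∧ b x = j} × {y // c y = j ∧ d y = k} :=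
    { toFun := fun p => ⟨b p.1.1.1, ⟨p.1.1.1, (Prod.mk.inj p.2).1, rfl⟩,
        ⟨p.1.1.2, p.1.2.symm, (Prod.mk.inj p.2).2⟩⟩
      invFun := fun s => ⟨⟨(s.2.1.1, s.2.2.1), s.2.1.2.2.trans s.2.2.2.1.symm⟩,
        Prod.ext s.2.1.2.1 s.2.2.2.2⟩
      left_inv := fun _ => rfl
      right_inv := by
        rintro ⟨j, ⟨x, hx, rfl⟩, ⟨y, hy, hy'⟩⟩
        rfl }
  rw [Nat.card_congr e, Nat.card_sigma]
  exact Finset.sum_congr rfl fun j _ => Nat.card_prod _ _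

variable {VG : Type u₁} {EG : Type v₁} {VH : Type u₂} {EH : Type v₂}
  {G : Graph VG EG} {H : Graph VH EH} {F : Matrix VH VG ℕ}

/-- The entry of `F A_G` at `(w, b)` is at least `F w a` times a positive number; as an entry of
`A_H F` it needs a nonzero entry of `F` in column `b`. Nonzero columns thus propagate forwards along
`G`, and nonzero rows backwards along `H`. -/
theorem exists_ne_zero_of_edge_left [Fintype VG] [Fintype VH] [Finite EG]
    (hF : F * G.adj = H.adj * F) {a b : VG}
    (he : ∃ e, G.i e = a ∧ G.t e = b) (h : ∃ w, F w a ≠ 0) : ∃ w, F w b ≠ 0 := by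
  obtain ⟨w, hw⟩ := h
  have h1 : (F * G.adj) w b ≠ 0 := fun h0 => by
    rw [Matrix.mul_apply, Finset.sum_eq_zero_iff] at h0
    exact mul_ne_zero hw (adj_pos_iff.2 he).ne' (h0 a (Finset.mem_univ a))
  rw [hF, Matrix.mul_apply] at h1
  obtain ⟨w', -, h2⟩ := Finset.exists_ne_zero_of_sum_ne_zero h1
  exact ⟨w', right_ne_zero_of_mul h2⟩

theorem exists_ne_zero_of_edge_right [Fintype VG] [Fintype VH] [Finite EH]
    (hF : F * G.adj = H.adj * F) {a b : VH}
    (he : ∃ e, H.i e = a ∧ H.t e = b) (h : ∃ v, F b v ≠ 0) : ∃ v, F a v ≠ 0 := by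
  obtain ⟨v, hv⟩ := h
  have h1 : (H.adj * F) a v ≠ 0 := fun h0 => by
    rw [Matrix.mul_apply, Finset.sum_eq_zero_iff] at h0
    exact mul_ne_zero (adj_pos_iff.2 he).ne' hv (h0 b (Finset.mem_univ b))
  rw [← hF, Matrix.mul_apply] at h1
  obtain ⟨v', -, h2⟩ := Finset.exists_ne_zero_of_sum_ne_zero h1
  exact ⟨v', left_ne_zero_of_mul h2⟩

theorem exists_row_ne_zero [Fintype VG] [Fintype VH] [Finite EG]
    (hF : F * G.adj = H.adj * F) (hF0 : F ≠ 0) (hG : G.IsIrreducible)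
    (v : VG) : ∃ w, F w v ≠ 0 := by
  obtain ⟨w₀, v₀, h0⟩ : ∃ w v, F w v ≠ 0 := by
    by_contra! h
    exact hF0 (Matrix.ext h)
  induction hG.2 v₀ v with
  | refl => exact ⟨w₀, h0⟩
  | tail _ he ih => exact exists_ne_zero_of_edge_left hF he ih

theorem exists_col_ne_zero [Fintype VG] [Fintype VH] [Finite EH]
    (hF : F * G.adj = H.adj * F) (hF0 : F ≠ 0) (hH : H.IsIrreducible)
    (w : VH) : ∃ v, F w v ≠ 0 := by
  obtain ⟨w₀, v₀, h0⟩ : ∃ w v, F w v ≠ 0 := by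
    by_contra! h
    exact hF0 (Matrix.ext h)
  induction hH.2 w w₀ using Relation.ReflTransGen.head_induction_on with
  | refl => exact ⟨v₀, h0⟩
  | head he _ ih => exact exists_ne_zero_of_edge_right hF he ih

/-- The edges of the graph are squares with an arrow of `F` on two opposite sides, an edge of `G`
and an edge of `H` on the others. Either path around a square determines it, which yields the two
covering properties. -/
theorem existsCorrespondence_of_intertwiner [Fintype VG] [Fintype VH] [Fintype EG] [Fintype EH]
    (hG : G.NoSourcesOrSinks) (hH : H.NoSourcesOrSinks)
    (hGirr : G.IsIrreducible) (hHirr : H.IsIrreducible) (hF0 : F ≠ 0)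
    (hF : F * G.adj = H.adj * F) : ExistsCorrespondence.{v₁, v₂, w} G.shift H.shift := by
  classical
  let VM : Type (max u₁ u₂) := Σ p : VH × VG, Fin (F p.1 p.2)
  let a : VM → VH := fun f => f.1.1
  let b : VM → VG := fun f => f.1.2
  have hcard : ∀ w v, Nat.card {f : VM // a f = w ∧ b f = v} = F w v := by
    intro w v
    have e : {f : VM // a f = w ∧ b f = v} ≃ {f : VM // f.1 = (w, v)} :=
      Equiv.subtypeEquivRight fun f => by simp [Prod.ext_iff, a, b]
    rw [Nat.card_congr (e.trans (Equiv.sigmaSubtype (w, v))), Nat.card_eq_fintype_card,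
      Fintype.card_fin]
  let P := {p : VM × EG // b p.1 = G.i p.2}
  let Q := {p : EH × VM // H.t p.1 = a p.2}
  -- The matrix equation, entry by entry, is the equality of these cardinalities.
  have hPQ : ∀ c : VH × VG, Nonempty ({p : P // (a p.1.1, G.t p.1.2) = c} ≃
      {p : Q // (H.i p.1.1, b p.1.2) = c}) := by
    rintro ⟨w, v⟩
    refine Finite.card_eq.1 ?_
    rw [card_composable a b G.i G.t w v, card_composable H.i H.t a b w v]
    simp only [hcard]
    exact congrFun (congrFun hF w) v
  let Φ : P ≃ Q := Equiv.ofFiberEquiv fun c => (hPQ c).some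
  have hΦ : ∀ p : P, (H.i (Φ p).1.1, b (Φ p).1.2) = (a p.1.1, G.t p.1.2) := fun p =>
    Equiv.ofFiberEquiv_map (g := fun p : Q => (H.i p.1.1, b p.1.2)) _ p
  -- Reindexing the edges puts the path space in the universe `w` required of the correspondence.
  let ε : ULift.{w} (Fin (Nat.card P)) ≃ P := Equiv.ulift.trans (Finite.equivFin P).symm
  let M : Graph VM (ULift.{w} (Fin (Nat.card P))) :=
    ⟨fun e => (ε e).1.1, fun e => (Φ (ε e)).1.2⟩
  have hMG : IsRightCovering M G b fun e => (ε e).1.2 :=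
    { i_map := fun e => (ε e).2.symm
      t_map := fun e => ((Prod.mk.inj (hΦ (ε e))).2).symm
      lift := fun f g h => ⟨ε.symm ⟨(f, g), h.symm⟩, by simp [M], by simp⟩
      inj := fun e e' h1 h2 => ε.injective (Subtype.ext (Prod.ext h1 h2)) }
  have hMH : IsHom M H a fun e => (Φ (ε e)).1.1 :=
    { i_map := fun e => (Prod.mk.inj (hΦ (ε e))).1
      t_map := fun e => (Φ (ε e)).2 }
  have hMHop : IsRightCovering M.op H.op a fun e => (Φ (ε e)).1.1 :=
    { i_map := hMH.t_map
      t_map := hMH.i_map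
      lift := fun f h hf => ⟨ε.symm (Φ.symm ⟨(h, f), hf⟩), by simp [M, op], by simp⟩
      inj := fun e e' h1 h2 =>
        ε.injective (Φ.injective (Subtype.ext (Prod.ext h2 h1))) }
  have hM : M.NoSourcesOrSinks := by
    refine ⟨fun f => ?_, fun f => ?_⟩
    · obtain ⟨h, hh⟩ := hH.1 (a f)
      obtain ⟨e, he, -⟩ := hMHop.lift f h hh
      exact ⟨e, he⟩
    · obtain ⟨g, hg⟩ := hG.2 (b f)
      obtain ⟨e, he, -⟩ := hMG.lift f g hg
      exact ⟨e, he⟩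
  -- Irreducibility of `G` and `H` leaves no column or row of `F` zero, so both coverings reach
  -- every vertex.
  have hb : Function.Surjective b := fun v => by
    obtain ⟨w, hw⟩ := exists_row_ne_zero hF hF0 hGirr v
    exact ⟨⟨(w, v), ⟨0, Nat.pos_of_ne_zero hw⟩⟩, rfl⟩
  have ha : Function.Surjective a := fun w => by
    obtain ⟨v, hv⟩ := exists_col_ne_zero hF hF0 hHirr w
    exact ⟨⟨(w, v), ⟨0, Nat.pos_of_ne_zero hv⟩⟩, rfl⟩
  exact ⟨M.Shift, inferInstance, M.shift, _, _, isSmaleSpace_shift, hMG.isUBijective hM hb,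
    IsRightCovering.isSBijective_of_op hMH hMHop hM ha⟩

theorem finitelyEquivalent_of_existsCorrespondence
    (h : ExistsCorrespondence.{v₁, v₂, w} G.shift H.shift) :
    FinitelyEquivalent.{v₁, v₂, w} G.shift H.shift := by
  obtain ⟨M, _, μ, πu, πs, hμ, hu, hs⟩ := h
  exact ⟨M, _, μ, πu, πs, hμ,
    ⟨hu.toIsFactorMap, hu.finiteToOne hμ (by norm_num) isExpansive_shift⟩,
    hs.toIsFactorMap, hs.finiteToOne hμ (by norm_num) isExpansive_shift⟩

end Correspondence

end Graph

end SmaleCorr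

/-! ### The cycle of implications -/

theorem mainTheorem1
    {VG : Type u₁} {EG : Type v₁} [Fintype VG] [Fintype EG]
    {VH : Type u₂} {EH : Type v₂} [Fintype VH] [Fintype EH]
    (G : SmaleCorr.Graph VG EG) (H : SmaleCorr.Graph VH EH)
    (hG : G.NoSourcesOrSinks) (hH : H.NoSourcesOrSinks)
    (hGirr : G.IsIrreducible) (hHirr : H.IsIrreducible) :
    List.TFAE
      [SmaleCorr.FinitelyEquivalent.{v₁, v₂, w} G.shift H.shift,
       SmaleCorr.entropy G.shift = SmaleCorr.entropy H.shift,
       ∃ F : Matrix VH VG ℕ, F ≠ 0 ∧ F * G.adj = H.adj * F,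
       SmaleCorr.ExistsCorrespondence.{v₁, v₂, w} G.shift H.shift] := by
  tfae_have 1 → 2 := fun h => h.entropy_eq
  tfae_have 2 → 3 := SmaleCorr.Graph.exists_intertwiner_of_entropy_eq hG hH hGirr hHirr
  tfae_have 3 → 4 := fun ⟨_, hF0, hF⟩ =>
    SmaleCorr.Graph.existsCorrespondence_of_intertwiner hG hH hGirr hHirr hF0 hF
  tfae_have 4 → 1 := SmaleCorr.Graph.finitelyEquivalent_of_existsCorrespondence
  tfae_finish
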